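/- Consider $N$ agents $\dot x_i=A_ix_i+B_iu_i+E_i\omega_i$, $y_i=C_ix_i$ ($i=1,\dots,N$) with states $x_i\in\mathbb R^{n_i}$, scalar inputs $u_i$ and scalar outputs $y_i$, subject to disturbances $\omega_i\in\mathbb R^{q_i}$ with $\dot\omega_i=S_i\omega_i$. Assume that each triple $(C_i,A_i,B_i)$ is minimal (controllable and observable) and each pair $(E_i,S_i)$ is observable. Let $(a_{ij})$ be the weighted adjacency matrix of an undirected graph on $\{1,\dots,N\}$, that is, $a_{ii}=0$ and $a_{ij}=a_{ji}\ge 0$, with an edge between $i$ and $j$ if and only if $a_{ij}>0$. Let $f_i:\mathbb R\to\mathbb R$ be twice differentiable and $d_i\in\mathbb R$, and consider the problem of minimizing $\sum_{i=1}^N f_i(y_i)$ over $y\in\mathbb R^N$ subject to $\sum_{i=1}^N y_i=\sum_{i=1}^N d_i$. Assume further: (1) the graph is connected; (2) for each $i$ there are constants $0<\underline h_i\le\bar h_i$ with $\underline h_i\le f_i''(s)\le \bar h_i$ for all $s\in\mathbb R$; (3) for each $i$ there are matrices $X_{i1},U_{i1},X_{i2},U_{i2}$ solving the regulator equations $$X_{i1}S_i=A_iX_{i1}+B_iU_{i1}+E_i,\quad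 0=C_iX_{i1},\qquad 0=A_iX_{i2}+B_iU_{i2},\quad 1=C_iX_{i2}.$$ Then there are matrices $K_{i1},\bar L_i$ such that $A_i+B_iK_{i1}$ and $S_i-\bar L_iE_i$ are Hurwitz, and the optimization problem has a unique optimal solution $y^*=(y_1^*,\dots,y_N^*)$. Moreover, for every choice of such matrices $K_{i1},\bar L_i$ and of solutions of the regulator equations, put $K_{i2}=U_{i1}-K_{i1}X_{i1}$ and $K_{i3}=U_{i2}-K_{i1}X_{i2}$ and consider the closed loop of the agents and disturbances with the distributed controller $$\begin{aligned} u_i&=K_{i1}x_i+K_{i2}\eta_i+K_{i3}z_i,\qquad \eta_i=\bar\eta_i+\bar L_ix_i,\\ \dot{\bar\eta}_i&=(S_i-\bar L_iE_i)\bar\eta_i+(S_i\bar L_i-\bar L_iE_i\bar L_i-\bar L_iA_i)x_i-\bar L_iB_iu_i,\\ \dot z_i&=-f_i'(z_i)+\lambda_i,\\ \dot\lambda_i&=-\sum_{j=1}^N a_{ij}(\lambda_i-\lambda_j)-\sum_{j=1}^N a_{ij}(v_i-v_j)+d_i-z_i,\\ \dot v_i&=\sum_{j=1}^N a_{ij}(\lambda_i-\lambda_j).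 \end{aligned}$$ From every initial state $(x,\omega,\bar\eta,z,\lambda,v)(0)$ the closed loop has a solution on $[0,\infty)$, and every output converges exponentially to the corresponding component of the optimal solution: there are constants $\gamma,M>0$, independent of the solution, such that along every solution on $[0,\infty)$ $$|y_i(t)-y_i^*|\le M\,\bigl(1+\|(x,\omega,\bar\eta,z,\lambda,v)(0)\|\bigr)\,e^{-\gamma t},\qquad t\ge 0,\ i=1,\dots,N.$$ -/

import Mathlib

namespace SteadyStateRegulation

open Matrix

section LinearSystems

/-- A real square matrix is Hurwitz if all its (complex) eigenvalues have negative real part. -/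
def IsHurwitz {n : ℕ} (M : Matrix (Fin n) (Fin n) ℝ) : Prop :=
  ∀ μ ∈ spectrum ℂ (M.map (algebraMap ℝ ℂ)), μ.re < 0

/-- Controllability of `(A, B)`: the matrix `[B, A B, …, A ^ (n - 1) B]` has rank `n`. -/
def IsControllable {n m : ℕ} (A : Matrix (Fin n) (Fin n) ℝ) (B : Matrix (Fin n) (Fin m) ℝ) :
    Prop :=
  (Matrix.of fun (i : Fin n) (p : Fin n × Fin m) => (A ^ (p.1 : ℕ) * B) i p.2).rank = n

/-- Observability of `(C, A)`: the matrix `col(C, C A, …, C A ^ (n - 1))` has rank `n`. -/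
def IsObservable {n m : ℕ} (C : Matrix (Fin m) (Fin n) ℝ) (A : Matrix (Fin n) (Fin n) ℝ) :
    Prop :=
  (Matrix.of fun (p : Fin n × Fin m) (j : Fin n) => (C * A ^ (p.1 : ℕ)) p.2 j).rank = n

/-- Minimality of the triple `(C, A, B)`: controllable and observable. -/
def IsMinimal {n m p : ℕ} (C : Matrix (Fin p) (Fin n) ℝ) (A : Matrix (Fin n) (Fin n) ℝ)
    (B : Matrix (Fin n) (Fin m) ℝ) : Prop :=
  IsControllable A B ∧ IsObservable C A

end LinearSystems

/-- The matrices of one agent `x' = A x + B u + E ω`, `y = C x` with scalar input and output,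
together with the generator `ω' = S ω` of its disturbance. -/
structure Agent (n q : ℕ) where
  A : Matrix (Fin n) (Fin n) ℝ
  B : Matrix (Fin n) (Fin 1) ℝ
  C : Matrix (Fin 1) (Fin n) ℝ
  E : Matrix (Fin n) (Fin q) ℝ
  S : Matrix (Fin q) (Fin q) ℝ

/-- The standing assumption on one agent: `(C, A, B)` is minimal and `(E, S)` is observable. -/
def Agent.Standing {n q : ℕ} (P : Agent n q) : Prop :=
  IsMinimal P.C P.A P.B ∧ IsObservable P.E P.S

/-- `(X₁, U₁)` and `(X₂, U₂)` solve the regulator equations of the agent. -/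
structure Agent.RegulatorEquations {n q : ℕ} (P : Agent n q)
    (X₁ : Matrix (Fin n) (Fin q) ℝ) (U₁ : Matrix (Fin 1) (Fin q) ℝ)
    (X₂ : Matrix (Fin n) (Fin 1) ℝ) (U₂ : Matrix (Fin 1) (Fin 1) ℝ) : Prop where
  state₁ : X₁ * P.S = P.A * X₁ + P.B * U₁ + P.E
  output₁ : 0 = P.C * X₁
  state₂ : 0 = P.A * X₂ + P.B * U₂
  output₂ : 1 = P.C * X₂

/-- The matrices chosen in the design of the controller of one agent. -/
structure Gains (n q : ℕ) where
  X₁ : Matrix (Fin n) (Fin q) ℝ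
  U₁ : Matrix (Fin 1) (Fin q) ℝ
  X₂ : Matrix (Fin n) (Fin 1) ℝ
  U₂ : Matrix (Fin 1) (Fin 1) ℝ
  K₁ : Matrix (Fin 1) (Fin n) ℝ
  Lbar : Matrix (Fin q) (Fin n) ℝ

namespace Gains

variable {n q : ℕ}

def K₂ (G : Gains n q) : Matrix (Fin 1) (Fin q) ℝ := G.U₁ - G.K₁ * G.X₁

def K₃ (G : Gains n q) : Matrix (Fin 1) (Fin 1) ℝ := G.U₂ - G.K₁ * G.X₂

/-- The requirements on the chosen matrices: the regulator equations hold, and `A + B K₁` and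
`S - Lbar E` are Hurwitz. -/
structure Admissible (G : Gains n q) (P : Agent n q) : Prop where
  regulator : P.RegulatorEquations G.X₁ G.U₁ G.X₂ G.U₂
  feedback : IsHurwitz (P.A + P.B * G.K₁)
  observer : IsHurwitz (P.S - G.Lbar * P.E)

end Gains

/-- An undirected weighted graph on `N` nodes, given by its weighted adjacency matrix. -/
structure WeightedGraph (N : ℕ) where
  a : Matrix (Fin N) (Fin N) ℝ
  diag : ∀ i, a i i = 0
  symm : ∀ i j, a i j = a j i
  nonneg : ∀ i j, 0 ≤ a i j

/-- The underlying simple graph: `i` and `j` are joined by an edge iff `a i j > 0`. -/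
def WeightedGraph.toSimpleGraph {N : ℕ} (𝒢 : WeightedGraph N) : SimpleGraph (Fin N) where
  Adj i j := 0 < 𝒢.a i j
  symm := ⟨fun i j h => by rw [𝒢.symm j i]; exact h⟩
  loopless := ⟨fun i h => by rw [𝒢.diag i] at h; exact lt_irrefl _ h⟩

/-- The local averages `∑ⱼ aᵢⱼ (pᵢ - pⱼ)` exchanged over the graph. -/
def WeightedGraph.diffusion {N : ℕ} (𝒢 : WeightedGraph N) (p : Fin N → ℝ) (i : Fin N) : ℝ :=
  ∑ j, 𝒢.a i j * (p i - p j)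

/-- `f : ℝ → ℝ` is twice differentiable and its Hessian lies between `hlo` and `hhi`. -/
structure HessianBounds (f : ℝ → ℝ) (hlo hhi : ℝ) : Prop where
  diff : Differentiable ℝ f
  diff_deriv : Differentiable ℝ (deriv f)
  lower : ∀ s, hlo ≤ deriv (deriv f) s
  upper : ∀ s, deriv (deriv f) s ≤ hhi

/-- The feasible set `∑ yᵢ = ∑ dᵢ` of the resource allocation problem. -/
def feasible {N : ℕ} (d : Fin N → ℝ) : Set (Fin N → ℝ) :=
  {y | ∑ i, y i = ∑ i, d i}

/-- `y` minimizes `∑ fᵢ(yᵢ)` subject to `∑ yᵢ = ∑ dᵢ`. -/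
def IsOptimal {N : ℕ} (f : Fin N → ℝ → ℝ) (d y : Fin N → ℝ) : Prop :=
  y ∈ feasible d ∧ IsMinOn (fun p : Fin N → ℝ => ∑ i, f i (p i)) (feasible d) y

/-- The state of the closed loop: agents `x`, disturbances `ω`, observers `ηbar`, and the optimal
signal generator `(z, lam, v)`. -/
@[ext]
structure NetState {N : ℕ} (n q : Fin N → ℕ) where
  x : ∀ i, Fin (n i) → ℝ
  ω : ∀ i, Fin (q i) → ℝ
  ηbar : ∀ i, Fin (q i) → ℝ
  z : Fin N → ℝ
  lam : Fin N → ℝ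
  v : Fin N → ℝ

/-- The size of a state, as a sum of norms of its components. -/
noncomputable def NetState.size {N : ℕ} {n q : Fin N → ℕ} (s : NetState n q) : ℝ :=
  ‖s.x‖ + ‖s.ω‖ + ‖s.ηbar‖ + ‖s.z‖ + ‖s.lam‖ + ‖s.v‖

section ClosedLoop

variable {N : ℕ} {n q : Fin N → ℕ}

/-- The output `yᵢ = Cᵢ xᵢ`. -/
def output (P : ∀ i, Agent (n i) (q i)) (s : NetState n q) (i : Fin N) : ℝ :=
  ((P i).C *ᵥ s.x i) 0

/-- The disturbance estimate `ηᵢ = ηbarᵢ + Lbarᵢ xᵢ`. -/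
def estimate (G : ∀ i, Gains (n i) (q i)) (s : NetState n q) (i : Fin N) : Fin (q i) → ℝ :=
  s.ηbar i + (G i).Lbar *ᵥ s.x i

/-- The control `uᵢ = Kᵢ₁ xᵢ + Kᵢ₂ ηᵢ + Kᵢ₃ zᵢ`. -/
def control (G : ∀ i, Gains (n i) (q i)) (s : NetState n q) (i : Fin N) : Fin 1 → ℝ :=
  (G i).K₁ *ᵥ s.x i + (G i).K₂ *ᵥ estimate G s i + (G i).K₃ *ᵥ (fun _ => s.z i)

/-- The right-hand side of the closed loop formed by the disturbed agents, the disturbance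
observers and the optimal signal generator. -/
noncomputable def closedLoop (P : ∀ i, Agent (n i) (q i)) (G : ∀ i, Gains (n i) (q i))
    (𝒢 : WeightedGraph N) (f : Fin N → ℝ → ℝ) (d : Fin N → ℝ) (s : NetState n q) :
    NetState n q where
  x i := (P i).A *ᵥ s.x i + (P i).B *ᵥ control G s i + (P i).E *ᵥ s.ω i
  ω i := (P i).S *ᵥ s.ω i
  ηbar i := ((P i).S - (G i).Lbar * (P i).E) *ᵥ s.ηbar i
    + ((P i).S * (G i).Lbar - (G i).Lbar * (P i).E * (G i).Lbar - (G i).Lbar * (P i).A) *ᵥ s.x i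
    - ((G i).Lbar * (P i).B) *ᵥ control G s i
  z i := -deriv (f i) (s.z i) + s.lam i
  lam i := -𝒢.diffusion s.lam i - 𝒢.diffusion s.v i + d i - s.z i
  v i := 𝒢.diffusion s.lam i

/-- `s` solves `s' = F s` on `[0, ∞)` (one-sided derivative at `0`). -/
structure IsTrajectory (F : NetState n q → NetState n q) (s : ℝ → NetState n q) : Prop where
  x : ∀ t, 0 ≤ t → ∀ i, HasDerivWithinAt (fun τ => (s τ).x i) ((F (s t)).x i) (Set.Ici 0) t
  ω : ∀ t, 0 ≤ t → ∀ i, HasDerivWithinAt (fun τ => (s τ).ω i) ((F (s t)).ω i) (Set.Ici 0) t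
  ηbar : ∀ t, 0 ≤ t → ∀ i,
    HasDerivWithinAt (fun τ => (s τ).ηbar i) ((F (s t)).ηbar i) (Set.Ici 0) t
  z : ∀ t, 0 ≤ t → ∀ i, HasDerivWithinAt (fun τ => (s τ).z i) ((F (s t)).z i) (Set.Ici 0) t
  lam : ∀ t, 0 ≤ t → ∀ i,
    HasDerivWithinAt (fun τ => (s τ).lam i) ((F (s t)).lam i) (Set.Ici 0) t
  v : ∀ t, 0 ≤ t → ∀ i, HasDerivWithinAt (fun τ => (s τ).v i) ((F (s t)).v i) (Set.Ici 0) t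

end ClosedLoop

end SteadyStateRegulation

/-! The closed loop is a cascade. The generator `(z, lam, v)` receives nothing from the agents, and
its equilibria are the optimality conditions: consensus of `lam` makes all `deriv (f i) (z i)` equal
to one multiplier, and `∑ z = ∑ d` because a Laplacian image sums to zero. Each agent then follows
`z i` while rejecting its disturbance.

The optimum: the derivatives are increasing bijections of the line, so the intermediate value
theorem yields a multiplier; strong convexity then gives optimality and uniqueness
(`exists_multiplier`, `add_sum_sq_le_of_multiplier`).

The generator: the plain energy of its error dissipates in `z` and in the disagreement of `lam`, but
not in `v`. Small cross terms between consecutive components turn it into a strict Lyapunov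
function, because the Laplacian of a connected graph is coercive on vectors of sum zero and the sum
of `v` is conserved (`exists_exp_bound_primalDual`).

An agent: put `e = η - ω` and `ξ = x - X₁ ω - X₂ y*`. The regulator equations give `e' = (S - Lbar
E) e` and `ξ' = (A + B K₁) ξ` plus terms linear in `e` and `z - y*`, while the output error is `C
ξ`. The disturbance itself, which may grow, has dropped out. Two uses of
`IsHurwitz.exists_exp_bound` carry the decay down the cascade.

Stabilizing gains come from Bass' construction and duality. Solutions are global because bounded
Hessians make the vector field globally Lipschitz. -/

namespace SteadyStateRegulation

open Matrix Filter Topology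
open scoped NNReal

/-! ### Stabilizing gains from controllability and observability. -/

section Stabilization

/-- A constant bounding the bilinear form of a real matrix in the sup norm. -/
theorem exists_abs_dotProduct_mulVec_le {m n : ℕ} (M : Matrix (Fin m) (Fin n) ℝ) :
    ∃ c : ℝ, 0 ≤ c ∧ ∀ x y, |x ⬝ᵥ (M *ᵥ y)| ≤ c * (‖x‖ * ‖y‖) := by
  refine ⟨∑ i, ∑ j, |M i j|, by positivity, fun x y => ?_⟩
  simp only [dotProduct, mulVec, Finset.mul_sum, Finset.sum_mul]
  refine (Finset.abs_sum_le_sum_abs _ _).trans (Finset.sum_le_sum fun i _ => ?_)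
  refine (Finset.abs_sum_le_sum_abs _ _).trans (Finset.sum_le_sum fun j _ => ?_)
  rw [abs_mul, abs_mul]
  have h1 := norm_le_pi_norm x i
  have h2 := norm_le_pi_norm y j
  rw [Real.norm_eq_abs] at h1 h2
  have := mul_le_mul h1 h2 (abs_nonneg _) (norm_nonneg _)
  nlinarith [abs_nonneg (M i j)]

theorem norm_sq_le_dotProduct_self {n : ℕ} (x : Fin n → ℝ) : ‖x‖ ^ 2 ≤ x ⬝ᵥ x := by
  rcases isEmpty_or_nonempty (Fin n) with h | h
  · simp [Subsingleton.elim x 0]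
  · obtain ⟨i, hi⟩ := Finite.exists_max fun i => ‖x i‖
    have h1 : ‖x‖ = ‖x i‖ :=
      le_antisymm ((pi_norm_le_iff_of_nonneg (norm_nonneg _)).2 hi) (norm_le_pi_norm x i)
    rw [h1, Real.norm_eq_abs, sq_abs, dotProduct, sq]
    exact Finset.single_le_sum (f := fun i => x i * x i) (fun j _ => mul_self_nonneg _)
      (Finset.mem_univ i)

/-- The Lyapunov operator of a matrix with positive definite symmetric part is onto. -/
theorem exists_lyapunov_solution {n : ℕ} {F : Matrix (Fin n) (Fin n) ℝ}
    (hF : ∀ x, x ≠ 0 → 0 < x ⬝ᵥ (F *ᵥ x)) {Q : Matrix (Fin n) (Fin n) ℝ} (hQ : Qᵀ = Q) :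
    ∃ W : Matrix (Fin n) (Fin n) ℝ, Wᵀ = W ∧ F * W + W * Fᵀ = Q := by
  let Λ : Matrix (Fin n) (Fin n) ℝ →ₗ[ℝ] Matrix (Fin n) (Fin n) ℝ :=
    LinearMap.mulLeft ℝ F + LinearMap.mulRight ℝ Fᵀ
  have hΛ : ∀ W, Λ W = F * W + W * Fᵀ := fun W => rfl
  have h0 : ∀ x, 0 ≤ x ⬝ᵥ (F *ᵥ x) := fun x => by
    by_cases hx : x = 0
    · simp [hx]
    · exact (hF x hx).le
  have hinj : Function.Injective Λ := by
    rw [← LinearMap.ker_eq_bot, LinearMap.ker_eq_bot']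
    intro W hW
    rw [hΛ] at hW
    -- Pairing the equation with `W` in the trace inner product gives the quadratic form of `F`
    -- summed over the columns of `W` and over its rows.
    have h1 : (Wᵀ * (F * W + W * Fᵀ)).trace = 0 := by simp [hW]
    have h2 : (Wᵀ * (F * W)).trace = ∑ j, (fun i => W i j) ⬝ᵥ (F *ᵥ (fun i => W i j)) := by
      simp [Matrix.trace, Matrix.mul_apply, dotProduct, mulVec]
    have h3 : (Wᵀ * (W * Fᵀ)).trace = ∑ j, (W j) ⬝ᵥ (F *ᵥ (W j)) := by
      rw [← Matrix.trace_mul_comm, ← Matrix.trace_transpose]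
      simp only [transpose_mul, transpose_transpose]
      simp [Matrix.trace, Matrix.mul_apply, dotProduct, mulVec]
    rw [Matrix.mul_add, Matrix.trace_add, h2, h3] at h1
    have h4 : ∑ j, (fun i => W i j) ⬝ᵥ (F *ᵥ (fun i => W i j)) = 0 := by
      have a := Finset.sum_nonneg fun j (_ : j ∈ Finset.univ) => h0 (fun i => W i j)
      have b := Finset.sum_nonneg fun j (_ : j ∈ Finset.univ) => h0 (W j)
      linarith
    rw [Finset.sum_eq_zero_iff_of_nonneg fun j _ => h0 _] at h4
    ext i j
    by_contra hne
    refine (hF (fun i => W i j) fun h => hne (congrFun h i)).ne' (h4 j (Finset.mem_univ _))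
  obtain ⟨W, hW⟩ := LinearMap.injective_iff_surjective.1 hinj Q
  -- As `Q` is symmetric, `Wᵀ` solves the same equation, and injectivity identifies it with `W`.
  refine ⟨W, hinj ?_, hW⟩
  rw [hW, hΛ, ← hQ, ← hW, hΛ]
  simp [add_comm]

/-- A matrix `G` with `G W + W Gᵀ = -2 β W`, `W` positive definite and `β > 0`, is Hurwitz. -/
theorem isHurwitz_of_lyapunov {n : ℕ} {G W : Matrix (Fin n) (Fin n) ℝ} {β : ℝ} (hβ : 0 < β)
    (hW : Wᵀ = W) (hpos : ∀ x, x ≠ 0 → 0 < x ⬝ᵥ (W *ᵥ x))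
    (h : G * W + W * Gᵀ = -(2 * β) • W) : IsHurwitz G := by
  intro μ hμ
  rw [spectrum.mem_iff, Matrix.isUnit_iff_isUnit_det, isUnit_iff_ne_zero, not_not,
    ← Matrix.exists_vecMul_eq_zero_iff] at hμ
  -- For a left eigenvector `u = a + i b` the identity `h`, evaluated at `a` and at `b` and added,
  -- gives `Re μ = -β`: the terms in `Im μ` cancel by symmetry of `W`.
  obtain ⟨u, hu0, hu⟩ := hμ
  have hsymm : ∀ x y : Fin n → ℝ, x ⬝ᵥ (W *ᵥ y) = y ⬝ᵥ (W *ᵥ x) := fun x y => by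
    rw [dotProduct_mulVec, ← mulVec_transpose, hW, dotProduct_comm]
  have key : ∀ x : Fin n → ℝ, 2 * ((Gᵀ *ᵥ x) ⬝ᵥ (W *ᵥ x)) = -(2 * β) * (x ⬝ᵥ (W *ᵥ x)) := by
    intro x
    have := congrArg (fun M => x ⬝ᵥ (M *ᵥ x)) h
    simp only [add_mulVec, dotProduct_add, smul_mulVec, dotProduct_smul, smul_eq_mul] at this
    rw [← this, ← mulVec_mulVec, ← mulVec_mulVec, hsymm x (Gᵀ *ᵥ x), dotProduct_mulVec x G,
      ← mulVec_transpose]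
    ring
  set a : Fin n → ℝ := fun i => (u i).re with ha
  set b : Fin n → ℝ := fun i => (u i).im with hb
  have hu' : ∀ i, ∑ j, u j * (G j i : ℂ) = u i * μ := by
    intro i
    have := congrFun hu i
    rw [vecMul_sub, Pi.sub_apply, Pi.zero_apply, sub_eq_zero] at this
    simp only [algebraMap_eq_diagonal] at this
    rw [vecMul_diagonal] at this
    simp only [vecMul, dotProduct, Matrix.map_apply] at this
    exact this.symm
  have hGa : Gᵀ *ᵥ a = μ.re • a - μ.im • b := by
    ext i
    have := congrArg Complex.re (hu' i)
    simp only [Complex.re_sum, Complex.mul_re, Complex.ofReal_re, Complex.ofReal_im, mul_zero,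
      sub_zero] at this
    simp only [mulVec, dotProduct, transpose_apply, Pi.sub_apply, Pi.smul_apply, smul_eq_mul, ha,
      hb]
    rw [mul_comm (μ.re), mul_comm μ.im, ← this]
    exact Finset.sum_congr rfl fun j _ => mul_comm _ _
  have hGb : Gᵀ *ᵥ b = μ.im • a + μ.re • b := by
    ext i
    have := congrArg Complex.im (hu' i)
    simp only [Complex.im_sum, Complex.mul_im, Complex.ofReal_re, Complex.ofReal_im, mul_zero,
      zero_add] at this
    simp only [mulVec, dotProduct, transpose_apply, Pi.add_apply, Pi.smul_apply, smul_eq_mul, ha,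
      hb]
    rw [mul_comm (μ.re), mul_comm μ.im, ← this]
    exact Finset.sum_congr rfl fun j _ => mul_comm _ _
  have e1 := key a
  have e2 := key b
  rw [hGa] at e1
  rw [hGb] at e2
  simp only [sub_dotProduct, add_dotProduct, smul_dotProduct, smul_eq_mul] at e1 e2
  rw [hsymm b a] at e1
  have hab : 0 < a ⬝ᵥ (W *ᵥ a) + b ⬝ᵥ (W *ᵥ b) := by
    have n1 : ∀ x, 0 ≤ x ⬝ᵥ (W *ᵥ x) := fun x => by
      by_cases hx : x = 0
      · simp [hx]
      · exact (hpos x hx).le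
    by_cases h1 : a = 0
    · by_cases h2 : b = 0
      · exact absurd (funext fun i => Complex.ext (congrFun h1 i) (congrFun h2 i)) hu0
      · exact add_pos_of_nonneg_of_pos (n1 a) (hpos b h2)
    · exact add_pos_of_pos_of_nonneg (hpos a h1) (n1 b)
  by_contra hre
  rw [not_lt] at hre
  nlinarith [mul_pos hβ hab, mul_nonneg hre hab.le]

/-- Bass' construction: a controllable pair is stabilizable by static state feedback. -/
theorem exists_isHurwitz_add_mul {n m : ℕ} (A : Matrix (Fin n) (Fin n) ℝ)
    (B : Matrix (Fin n) (Fin m) ℝ)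
    (h : ∀ v, (∀ k < n, Bᵀ *ᵥ ((Aᵀ ^ k) *ᵥ v) = 0) → v = 0) :
    ∃ K : Matrix (Fin m) (Fin n) ℝ, IsHurwitz (A + B * K) := by
  obtain ⟨c, hc0, hc⟩ := exists_abs_dotProduct_mulVec_le A
  -- The shift exceeds the bound on the form of `A`, so `F` has positive definite symmetric part.
  set β : ℝ := c + 1 with hβ
  set F : Matrix (Fin n) (Fin n) ℝ := A + β • 1 with hF
  have hFq : ∀ x, x ≠ 0 → 0 < x ⬝ᵥ (F *ᵥ x) := by
    intro x hx
    have h1 := (abs_le.1 (hc x x)).1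
    have h2 := norm_sq_le_dotProduct_self x
    have h3 : 0 < ‖x‖ := norm_pos_iff.2 hx
    rw [hF, add_mulVec, dotProduct_add, smul_mulVec, one_mulVec, dotProduct_smul, smul_eq_mul, hβ]
    nlinarith [pow_pos h3 2]
  obtain ⟨W, hWs, hW⟩ := exists_lyapunov_solution hFq (Q := (2 : ℝ) • (B * Bᵀ)) (by simp)
  have hsymm : ∀ x y : Fin n → ℝ, x ⬝ᵥ (W *ᵥ y) = (W *ᵥ x) ⬝ᵥ y := fun x y => by
    rw [dotProduct_mulVec, ← mulVec_transpose, hWs]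
  have heig : ∀ (v : Fin n → ℝ) (w : ℝ), W *ᵥ v = w • v →
      w * (v ⬝ᵥ (F *ᵥ v)) = (Bᵀ *ᵥ v) ⬝ᵥ (Bᵀ *ᵥ v) := by
    intro v w hv
    have := congrArg (fun M => v ⬝ᵥ (M *ᵥ v)) hW
    simp only [add_mulVec, dotProduct_add, smul_mulVec, dotProduct_smul, smul_eq_mul,
      ← mulVec_mulVec] at this
    rw [hv, mulVec_smul, dotProduct_smul, hsymm, hv, smul_dotProduct, dotProduct_mulVec v Fᵀ,
      vecMul_transpose, dotProduct_mulVec v B, ← mulVec_transpose, dotProduct_comm (F *ᵥ v)] at this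
    simp only [smul_eq_mul] at this
    linarith
  -- The kernel of `W` lies in that of `Bᵀ` and is invariant under `Aᵀ`, hence trivial by `h`. With
  -- `heig`, which makes the eigenvalues nonnegative, `W` is positive definite.
  have hker : ∀ v, W *ᵥ v = 0 → v = 0 := by
    have step : ∀ v, W *ᵥ v = 0 → Bᵀ *ᵥ v = 0 ∧ W *ᵥ (Aᵀ *ᵥ v) = 0 := by
      intro v hv
      have h1 : Bᵀ *ᵥ v = 0 := by
        rw [← dotProduct_self_eq_zero, ← heig v 0 (by simp [hv]), zero_mul]
      refine ⟨h1, ?_⟩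
      have := congrArg (fun M => M *ᵥ v) hW
      simp only [add_mulVec, smul_mulVec, ← mulVec_mulVec, hv, h1, mulVec_zero, smul_zero,
        zero_add, hF, transpose_add, transpose_smul, transpose_one, mulVec_add, one_mulVec,
        mulVec_smul, add_zero] at this
      exact this
    intro v hv
    have hk : ∀ k, W *ᵥ ((Aᵀ ^ k) *ᵥ v) = 0 := by
      intro k
      induction k with
      | zero => simpa using hv
      | succ k ih =>
        rw [pow_succ', ← mulVec_mulVec]
        exact (step _ ih).2
    exact h v fun k _ => (step _ (hk k)).1
  have hH : W.IsHermitian := by rw [IsHermitian, conjTranspose_eq_transpose_of_trivial, hWs]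
  have hpd : W.PosDef := by
    rw [hH.posDef_iff_eigenvalues_pos]
    intro i
    set v : Fin n → ℝ := ⇑(hH.eigenvectorBasis i) with hv
    have h1 : W *ᵥ v = hH.eigenvalues i • v := hH.mulVec_eigenvectorBasis i
    have h2 : v ≠ 0 := fun h0 => (hH.eigenvectorBasis.orthonormal.ne_zero i) (by
      ext j; exact congrFun h0 j)
    have h3 := heig v _ h1
    have h4 := hFq v h2
    have h5 : 0 ≤ (Bᵀ *ᵥ v) ⬝ᵥ (Bᵀ *ᵥ v) := (sq_nonneg _).trans (norm_sq_le_dotProduct_self _)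
    have h6 : 0 ≤ hH.eigenvalues i := by
      by_contra hlt
      rw [not_le] at hlt
      nlinarith [mul_neg_of_neg_of_pos hlt h4]
    refine lt_of_le_of_ne h6 fun h7 => h2 (hker v ?_)
    rw [h1, ← h7, zero_smul]
  have hdet : IsUnit W.det := (hpd.det_pos.ne').isUnit
  -- This feedback subtracts `2 B Bᵀ` from `A W + W Aᵀ`, leaving exactly `-2 β W`.
  refine ⟨-(Bᵀ * W⁻¹), isHurwitz_of_lyapunov (W := W) (β := β) (by positivity) hWs
    (fun x hx => by simpa using hpd.dotProduct_mulVec_pos hx) ?_⟩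
  have e1 : W⁻¹ * W = 1 := nonsing_inv_mul _ hdet
  have e2 : W * W⁻¹ = 1 := mul_nonsing_inv _ hdet
  have e3 : A * W + W * Aᵀ + (2 * β) • W = (2 : ℝ) • (B * Bᵀ) := by
    rw [← hW, hF]
    simp only [Matrix.add_mul, Matrix.mul_add, transpose_add, transpose_smul, transpose_one,
      Matrix.smul_mul, Matrix.mul_smul, Matrix.one_mul, Matrix.mul_one]
    module
  have e4 : B * -(Bᵀ * W⁻¹) * W = -(B * Bᵀ) := by
    simp [Matrix.mul_assoc, e1]
  have e5 : W * (B * -(Bᵀ * W⁻¹))ᵀ = -(B * Bᵀ) := by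
    rw [← transpose_transpose (W * _), transpose_mul, transpose_transpose, hWs, e4]
    simp
  rw [Matrix.add_mul, transpose_add, Matrix.mul_add, e4, e5]
  have : A * W + W * Aᵀ = (2 : ℝ) • (B * Bᵀ) - (2 * β) • W := eq_sub_of_add_eq e3
  calc _ = (A * W + W * Aᵀ) - (2 : ℝ) • (B * Bᵀ) := by module
    _ = _ := by rw [this]; module

theorem IsHurwitz.transpose {n : ℕ} {M : Matrix (Fin n) (Fin n) ℝ} (h : IsHurwitz M) :
    IsHurwitz Mᵀ := by
  intro μ hμ
  refine h μ ?_
  rw [spectrum.mem_iff] at hμ ⊢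
  rw [← Matrix.isUnit_transpose]
  simpa [algebraMap_eq_diagonal, transpose_map] using hμ

/-- Full rank makes the rows of the controllability matrix independent, so no nonzero vector is
annihilated by all `Bᵀ (Aᵀ) ^ k` with `k < n`. -/
theorem IsControllable.exists_isHurwitz {n m : ℕ} {A : Matrix (Fin n) (Fin n) ℝ}
    {B : Matrix (Fin n) (Fin m) ℝ} (h : IsControllable A B) :
    ∃ K : Matrix (Fin m) (Fin n) ℝ, IsHurwitz (A + B * K) := by
  refine exists_isHurwitz_add_mul A B fun v hv => ?_
  have hli : LinearIndependent ℝ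
      (Matrix.of fun (i : Fin n) (p : Fin n × Fin m) => (A ^ (p.1 : ℕ) * B) i p.2).row := by
    rw [linearIndependent_iff_card_eq_finrank_span, Set.finrank,
      ← Matrix.rank_eq_finrank_span_row, h, Fintype.card_fin]
  rw [← Matrix.vecMul_injective_iff] at hli
  refine hli ?_
  simp only [zero_vecMul]
  ext p
  have := congrFun (hv p.1 p.1.2) p.2
  rw [mulVec_mulVec, ← transpose_pow, ← transpose_mul, mulVec_transpose] at this
  exact this

/-- Duality: the pair `(Aᵀ, Cᵀ)` is controllable, and transposition preserves the spectrum. -/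
theorem IsObservable.exists_isHurwitz {n m : ℕ} {A : Matrix (Fin n) (Fin n) ℝ}
    {C : Matrix (Fin m) (Fin n) ℝ} (h : IsObservable C A) :
    ∃ L : Matrix (Fin n) (Fin m) ℝ, IsHurwitz (A - L * C) := by
  have : IsControllable Aᵀ Cᵀ := by
    rw [IsControllable, ← Matrix.rank_transpose]
    rw [IsObservable] at h
    convert h using 1
    congr 1
    ext p j
    simp only [transpose_apply, of_apply, ← transpose_pow, ← transpose_mul]
  obtain ⟨K, hK⟩ := this.exists_isHurwitz
  refine ⟨-Kᵀ, ?_⟩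
  convert hK.transpose using 1
  simp [transpose_mul]

end Stabilization

/-! ### Lyapunov functions and decay of Hurwitz systems. -/

section ExponentialStability

/-- If all eigenvalues of a real matrix lie in the open unit disc, its powers tend to zero. -/
theorem tendsto_pow_entry_of_spectrum {n : ℕ} {T : Matrix (Fin n) (Fin n) ℝ}
    (hT : ∀ μ ∈ spectrum ℂ (T.map (algebraMap ℝ ℂ)), ‖μ‖ < 1) (i j : Fin n) :
    Tendsto (fun k : ℕ => (T ^ k) i j) atTop (𝓝 0) := by
  let _ : NormedRing (Matrix (Fin n) (Fin n) ℂ) := Matrix.linftyOpNormedRing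
  let _ : NormedAlgebra ℂ (Matrix (Fin n) (Fin n) ℂ) := Matrix.linftyOpNormedAlgebra
  have _ : CompleteSpace (Matrix (Fin n) (Fin n) ℂ) := FiniteDimensional.complete ℂ _
  set Tc := T.map (algebraMap ℝ ℂ) with hTc
  have hrad : spectralRadius ℂ Tc < 1 := by
    rcases (spectrum ℂ Tc).eq_empty_or_nonempty with he | hne
    · simp [spectralRadius, he]
    · obtain ⟨μ, hμ, hr⟩ := spectrum.exists_nnnorm_eq_spectralRadius_of_nonempty hne
      rw [← hr]
      exact_mod_cast hT μ hμ
  -- By Gelfand's formula `‖Tc ^ k‖ ≤ r ^ k` eventually, for any `r` strictly between the spectral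
  -- radius and 1.
  have hG := spectrum.pow_nnnorm_pow_one_div_tendsto_nhds_spectralRadius Tc
  obtain ⟨r, hr1, hr2⟩ := ENNReal.lt_iff_exists_nnreal_btwn.1 hrad
  have hr2' : (r : ℝ) < 1 := by exact_mod_cast hr2
  have hev : ∀ᶠ k : ℕ in atTop, ‖Tc ^ k‖ ≤ (r : ℝ) ^ k := by
    filter_upwards [hG.eventually_lt_const hr1, eventually_gt_atTop 0] with k hk hk0
    have hk' : (0 : ℝ) < k := by exact_mod_cast hk0
    rw [one_div, ENNReal.rpow_inv_lt_iff hk', ENNReal.rpow_natCast] at hk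
    exact_mod_cast hk.le
  have h0 : Tendsto (fun k : ℕ => Tc ^ k) atTop (𝓝 0) :=
    squeeze_zero_norm' hev (tendsto_pow_atTop_nhds_zero_of_lt_one r.2 hr2')
  have h1 : Tendsto (fun k : ℕ => (Tc ^ k) i j) atTop (𝓝 0) := by
    have : Continuous fun M : Matrix (Fin n) (Fin n) ℂ => M i j :=
      continuous_id.matrix_elem i j
    exact (this.tendsto 0).comp h0
  have h2 : ∀ k : ℕ, (Tc ^ k) i j = ((T ^ k) i j : ℂ) := fun k => by
    rw [hTc, ← Matrix.map_pow]; rfl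
  rw [tendsto_zero_iff_norm_tendsto_zero] at h1 ⊢
  refine h1.congr fun k => ?_
  rw [h2, Complex.norm_real]

/-- The Lyapunov inequality of a Hurwitz matrix. -/
theorem IsHurwitz.exists_lyapunov {n : ℕ} {M : Matrix (Fin n) (Fin n) ℝ} (hM : IsHurwitz M) :
    ∃ (P : Matrix (Fin n) (Fin n) ℝ) (c : ℝ), 0 < c ∧ Pᵀ = P ∧ (∀ x, ‖x‖ ^ 2 ≤ x ⬝ᵥ (P *ᵥ x)) ∧
      ∀ x, x ⬝ᵥ (P *ᵥ (M *ᵥ x)) ≤ -c * ‖x‖ ^ 2 := by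
  -- An Euler step `T = 1 + h M` replaces the matrix exponential. Since `‖1 + h μ‖² = 1 + h (2 Re μ
  -- + h ‖μ‖²)`, a small `h` works for the whole finite spectrum.
  obtain ⟨h, hh0, hh⟩ : ∃ h : ℝ, 0 < h ∧
      ∀ μ ∈ spectrum ℂ (M.map (algebraMap ℝ ℂ)), ‖1 + (h : ℂ) * μ‖ < 1 := by
    have hfin : (spectrum ℂ (M.map (algebraMap ℝ ℂ))).Finite := Matrix.finite_spectrum _
    have hev : ∀ᶠ h : ℝ in 𝓝[>] 0,
        ∀ μ ∈ spectrum ℂ (M.map (algebraMap ℝ ℂ)), ‖1 + (h : ℂ) * μ‖ < 1 := by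
      rw [hfin.eventually_all]
      intro μ hμ
      have hre := hM μ hμ
      have hc : Tendsto (fun h : ℝ => 2 * μ.re + h * (μ.re ^ 2 + μ.im ^ 2)) (𝓝[>] 0)
          (𝓝 (2 * μ.re + 0 * (μ.re ^ 2 + μ.im ^ 2))) :=
        Tendsto.mono_left (Continuous.tendsto (by fun_prop) _) nhdsWithin_le_nhds
      filter_upwards [hc.eventually_lt_const (show _ < (0 : ℝ) by linarith), self_mem_nhdsWithin]
        with h h1 h2
      rw [Set.mem_Ioi] at h2
      rw [← sq_lt_one_iff₀ (norm_nonneg _), ← Complex.normSq_eq_norm_sq, Complex.normSq_apply]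
      simp only [Complex.add_re, Complex.one_re, Complex.mul_re, Complex.ofReal_re,
        Complex.ofReal_im, zero_mul, sub_zero, Complex.add_im, Complex.one_im, Complex.mul_im,
        zero_add, add_zero]
      nlinarith [mul_neg_of_pos_of_neg h2 h1]
    obtain ⟨h, h1, h2⟩ := (hev.and self_mem_nhdsWithin).exists
    exact ⟨h, h2, h1⟩
  set T : Matrix (Fin n) (Fin n) ℝ := 1 + h • M with hTdef
  have hT : ∀ μ ∈ spectrum ℂ (T.map (algebraMap ℝ ℂ)), ‖μ‖ < 1 := by
    intro μ hμ
    have hne : (h : ℂ) ≠ 0 := by exact_mod_cast hh0.ne'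
    have hmem : (μ - 1) / h ∈ spectrum ℂ (M.map (algebraMap ℝ ℂ)) := by
      rw [spectrum.mem_iff, Matrix.isUnit_iff_isUnit_det, isUnit_iff_ne_zero, not_not,
        ← Matrix.exists_mulVec_eq_zero_iff] at hμ ⊢
      obtain ⟨u, hu0, hu⟩ := hμ
      refine ⟨u, hu0, ?_⟩
      have hTM : T.map (algebraMap ℝ ℂ) = 1 + (h : ℂ) • M.map (algebraMap ℝ ℂ) := by
        ext i j
        by_cases hij : i = j <;> simp [hTdef, hij]
      rw [hTM, Algebra.algebraMap_eq_smul_one, sub_mulVec, add_mulVec, smul_mulVec, smul_mulVec,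
        one_mulVec] at hu
      rw [Algebra.algebraMap_eq_smul_one, sub_mulVec, smul_mulVec, one_mulVec]
      rw [← smul_right_injective _ hne |>.eq_iff, smul_zero, smul_sub, smul_smul,
        mul_div_cancel₀ _ hne, ← hu]
      module
    have := hh _ hmem
    rwa [mul_div_cancel₀ _ hne, add_sub_cancel] at this
  have hTK : ∃ K : ℕ, 0 < K ∧ ∀ x : Fin n → ℝ, ((T ^ K) *ᵥ x) ⬝ᵥ ((T ^ K) *ᵥ x) ≤ 1 / 2 * ‖x‖ ^ 2 := by
    have hlim : Tendsto (fun k : ℕ => ∑ i, (∑ j, |(T ^ k) i j|) ^ 2) atTop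
        (𝓝 (∑ _i : Fin n, (∑ _j : Fin n, |(0 : ℝ)|) ^ 2)) :=
      tendsto_finsetSum _ fun i _ => (tendsto_finsetSum _ fun j _ =>
        (tendsto_pow_entry_of_spectrum hT i j).abs).pow 2
    obtain ⟨K, hK, hK0⟩ := (hlim.eventually_lt_const
      (show _ < (1 / 2 : ℝ) by simp)).and (eventually_gt_atTop 0) |>.exists
    refine ⟨K, hK0, fun x => le_trans ?_ (mul_le_mul_of_nonneg_right hK.le (sq_nonneg _))⟩
    rw [dotProduct, Finset.sum_mul]
    refine Finset.sum_le_sum fun i _ => ?_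
    rw [← sq, ← mul_pow, ← sq_abs]
    refine pow_le_pow_left₀ (abs_nonneg _) ?_ 2
    rw [mulVec, dotProduct, Finset.sum_mul]
    refine (Finset.abs_sum_le_sum_abs _ _).trans (Finset.sum_le_sum fun j _ => ?_)
    rw [abs_mul]
    exact mul_le_mul_of_nonneg_left (norm_le_pi_norm x j) (abs_nonneg _)
  obtain ⟨K, hK0, hK⟩ := hTK
  -- A finite sum suffices because `T ^ K` already contracts; `K > 0` keeps the term `k = 0`, which
  -- gives the lower bound.
  set P : Matrix (Fin n) (Fin n) ℝ := ∑ k ∈ Finset.range K, (T ^ k)ᵀ * T ^ k with hP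
  have hPs : Pᵀ = P := by simp [hP, transpose_sum]
  have hq : ∀ x, x ⬝ᵥ (P *ᵥ x) = ∑ k ∈ Finset.range K, ((T ^ k) *ᵥ x) ⬝ᵥ ((T ^ k) *ᵥ x) := by
    intro x
    rw [hP, sum_mulVec, dotProduct_sum]
    refine Finset.sum_congr rfl fun k _ => ?_
    rw [← mulVec_mulVec, dotProduct_mulVec, vecMul_transpose]
  have hlow : ∀ x, ‖x‖ ^ 2 ≤ x ⬝ᵥ (P *ᵥ x) := by
    intro x
    rw [hq]
    refine (norm_sq_le_dotProduct_self x).trans ?_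
    have := Finset.single_le_sum (f := fun k => ((T ^ k) *ᵥ x) ⬝ᵥ ((T ^ k) *ᵥ x))
      (fun k _ => (sq_nonneg _).trans (norm_sq_le_dotProduct_self _)) (Finset.mem_range.2 hK0)
    simpa using this
  -- The change of the form of `P` under `T` telescopes to at most `-‖x‖² / 2`. Expanded in `h` it
  -- is `2 h x ⬝ᵥ P M x` plus a nonnegative square term, whence the rate.
  refine ⟨P, 1 / (4 * h), by positivity, hPs, hlow, fun x => ?_⟩
  have h1 : (T *ᵥ x) ⬝ᵥ (P *ᵥ (T *ᵥ x)) - x ⬝ᵥ (P *ᵥ x)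
      = ((T ^ K) *ᵥ x) ⬝ᵥ ((T ^ K) *ᵥ x) - x ⬝ᵥ x := by
    rw [hq, hq, ← Finset.sum_sub_distrib]
    have := Finset.sum_range_sub (fun k => ((T ^ k) *ᵥ x) ⬝ᵥ ((T ^ k) *ᵥ x)) K
    simp only [pow_zero, one_mulVec] at this
    rw [← this]
    simp only [mulVec_mulVec, pow_succ]
  have hsymm : (M *ᵥ x) ⬝ᵥ (P *ᵥ x) = x ⬝ᵥ (P *ᵥ (M *ᵥ x)) := by
    rw [dotProduct_mulVec x P, ← mulVec_transpose, hPs, dotProduct_comm]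
  have h2 : (T *ᵥ x) ⬝ᵥ (P *ᵥ (T *ᵥ x)) = x ⬝ᵥ (P *ᵥ x) + 2 * h * (x ⬝ᵥ (P *ᵥ (M *ᵥ x)))
      + h ^ 2 * ((M *ᵥ x) ⬝ᵥ (P *ᵥ (M *ᵥ x))) := by
    rw [hTdef]
    simp only [add_mulVec, one_mulVec, smul_mulVec, mulVec_add, mulVec_smul, add_dotProduct,
      dotProduct_add, smul_dotProduct, dotProduct_smul, smul_eq_mul, hsymm]
    ring
  have h3 := (sq_nonneg _).trans (hlow (M *ᵥ x))
  have h4 := hK x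
  have h5 := norm_sq_le_dotProduct_self x
  have h6 := mul_nonneg (sq_nonneg h) h3
  have h7 : 2 * h * (x ⬝ᵥ (P *ᵥ (M *ᵥ x))) ≤ -(1 / 2) * ‖x‖ ^ 2 := by linarith
  calc x ⬝ᵥ (P *ᵥ (M *ᵥ x)) = 1 / (2 * h) * (2 * h * (x ⬝ᵥ (P *ᵥ (M *ᵥ x)))) := by field_simp
    _ ≤ 1 / (2 * h) * (-(1 / 2) * ‖x‖ ^ 2) := mul_le_mul_of_nonneg_left h7 (by positivity)
    _ = _ := by field_simp; ring

/-- A scalar comparison principle with exponentially decaying forcing. -/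
theorem le_mul_exp_of_deriv_le {V V' : ℝ → ℝ} {a b c γ : ℝ}
    (hV : ∀ t, 0 ≤ t → HasDerivWithinAt V (V' t) (Set.Ici 0) t)
    (hV' : ∀ t, 0 ≤ t → V' t ≤ -a * V t + b * Real.exp (-c * t))
    (hpos : ∀ t, 0 ≤ t → 0 ≤ V t) (hb : 0 ≤ b) (ha : γ ≤ a) (hc : γ < c) {t : ℝ} (ht : 0 ≤ t) :
    V t ≤ (V 0 + b / (c - γ)) * Real.exp (-γ * t) := by
  -- The second summand has derivative `-b exp (-(c - γ) t)`, which absorbs the forcing, so `W` is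
  -- antitone.
  set W : ℝ → ℝ := fun t => Real.exp (γ * t) * V t + b / (c - γ) * Real.exp (-(c - γ) * t) with hW
  have hcγ : 0 < c - γ := sub_pos.2 hc
  have hWd : ∀ t, 0 ≤ t → HasDerivWithinAt W (Real.exp (γ * t) * (γ * V t + V' t)
      - b * Real.exp (-(c - γ) * t)) (Set.Ici 0) t := by
    intro t ht
    have e1 : HasDerivAt (fun t => Real.exp (γ * t)) (Real.exp (γ * t) * γ) t := by
      simpa using ((hasDerivAt_id t).const_mul γ).exp
    have e2 : HasDerivAt (fun t => Real.exp (-(c - γ) * t))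
        (Real.exp (-(c - γ) * t) * (-(c - γ))) t := by
      simpa using ((hasDerivAt_id t).const_mul (-(c - γ))).exp
    refine ((e1.hasDerivWithinAt.mul (hV t ht)).add
      (e2.hasDerivWithinAt.const_mul (b / (c - γ)))).congr_deriv ?_
    field_simp
    ring
  have hanti : AntitoneOn W (Set.Ici 0) := by
    refine antitoneOn_of_deriv_nonpos (convex_Ici 0)
      (fun t ht => (hWd t ht).continuousWithinAt) (fun t ht => ?_) (fun t ht => ?_)
    · rw [interior_Ici, Set.mem_Ioi] at ht
      exact ((hWd t ht.le).hasDerivAt (Ici_mem_nhds ht)).differentiableAt.differentiableWithinAt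
    · rw [interior_Ici, Set.mem_Ioi] at ht
      rw [((hWd t ht.le).hasDerivAt (Ici_mem_nhds ht)).deriv]
      have h1 : Real.exp (-(c - γ) * t) = Real.exp (γ * t) * Real.exp (-c * t) := by
        rw [← Real.exp_add]; congr 1; ring
      rw [h1]
      have h2 : γ * V t + V' t - b * Real.exp (-c * t) ≤ 0 := by
        nlinarith [hV' t ht.le, mul_nonneg (sub_nonneg.2 ha) (hpos t ht.le)]
      nlinarith [mul_nonneg (Real.exp_pos (γ * t)).le (neg_nonneg.2 h2)]
  have h0 : W t ≤ V 0 + b / (c - γ) := by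
    have := hanti Set.self_mem_Ici ht ht
    simpa [hW] using this
  have h1 : Real.exp (γ * t) * V t ≤ V 0 + b / (c - γ) := by
    refine le_trans ?_ h0
    simp only [hW]
    exact le_add_of_nonneg_right (by positivity)
  calc V t = Real.exp (γ * t) * V t * Real.exp (-γ * t) := by
        rw [mul_right_comm, ← Real.exp_add]; simp
    _ ≤ _ := mul_le_mul_of_nonneg_right h1 (Real.exp_pos _).le

theorem hasDerivWithinAt_dotProduct {n : ℕ} {x y : ℝ → Fin n → ℝ} {x' y' : Fin n → ℝ} {s : Set ℝ}
    {t : ℝ} (hx : HasDerivWithinAt x x' s t) (hy : HasDerivWithinAt y y' s t) :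
    HasDerivWithinAt (fun τ => x τ ⬝ᵥ y τ) (x' ⬝ᵥ y t + x t ⬝ᵥ y') s t := by
  rw [hasDerivWithinAt_pi] at hx hy
  simp only [dotProduct, ← Finset.sum_add_distrib]
  exact HasDerivWithinAt.fun_sum fun i _ => (hx i).mul (hy i)

theorem hasDerivWithinAt_mulVec {m n : ℕ} (M : Matrix (Fin m) (Fin n) ℝ) {x : ℝ → Fin n → ℝ}
    {x' : Fin n → ℝ} {s : Set ℝ} {t : ℝ} (hx : HasDerivWithinAt x x' s t) :
    HasDerivWithinAt (fun τ => M *ᵥ x τ) (M *ᵥ x') s t := by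
  rw [hasDerivWithinAt_pi] at hx ⊢
  intro i
  simp only [mulVec, dotProduct]
  exact HasDerivWithinAt.fun_sum fun j _ => (hx j).const_mul _

/-- A Hurwitz linear system with exponentially decaying input decays exponentially. -/
theorem IsHurwitz.exists_exp_bound {n : ℕ} {M : Matrix (Fin n) (Fin n) ℝ} (hM : IsHurwitz M)
    {c : ℝ} (hc : 0 < c) :
    ∃ γ C : ℝ, 0 < γ ∧ γ ≤ c ∧ 0 < C ∧ ∀ (x g : ℝ → Fin n → ℝ) (b : ℝ), 0 ≤ b →
      (∀ t, 0 ≤ t → HasDerivWithinAt x (M *ᵥ x t + g t) (Set.Ici 0) t) →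
      (∀ t, 0 ≤ t → ‖g t‖ ≤ b * Real.exp (-c * t)) →
      ∀ t, 0 ≤ t → ‖x t‖ ≤ C * (‖x 0‖ + b) * Real.exp (-γ * t) := by
  obtain ⟨P, κ, hκ, hPs, hlow, hdec⟩ := hM.exists_lyapunov
  obtain ⟨D₀, hD₀, hPD₀⟩ := exists_abs_dotProduct_mulVec_le P
  obtain ⟨D, hD1, hPD⟩ : ∃ D : ℝ, 1 ≤ D ∧ ∀ x y, |x ⬝ᵥ (P *ᵥ y)| ≤ D * (‖x‖ * ‖y‖) :=
    ⟨D₀ + 1, by linarith, fun x y => (hPD₀ x y).trans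
      (mul_le_mul_of_nonneg_right (by linarith) (by positivity))⟩
  have hD : 0 < D := by linarith
  -- The quadratic function decays at rate `2 γ`, which must be at most its own rate `κ / D` and
  -- strictly below the rate `2 c` of the squared input.
  set γ := min (κ / (2 * D)) (c / 2) with hγ
  have hγ0 : 0 < γ := by positivity
  have hγ1 : 2 * γ ≤ κ / D := by
    have := min_le_left (κ / (2 * D)) (c / 2)
    rw [← hγ] at this
    calc 2 * γ ≤ 2 * (κ / (2 * D)) := by linarith
      _ = κ / D := by field_simp
  have hγ2 : γ ≤ c / 2 := min_le_right _ _
  have hcγ : 2 * γ < 2 * c := by linarith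
  set E : ℝ := D + D ^ 2 / κ / (2 * c - 2 * γ) with hE
  have h2cγ : 0 < 2 * c - 2 * γ := by linarith
  have hE0 : 0 < E := by positivity
  refine ⟨γ, Real.sqrt E, hγ0, by linarith, Real.sqrt_pos.2 hE0,
    fun x g b hb hx hg t ht => ?_⟩
  have hV : ∀ t, 0 ≤ t → HasDerivWithinAt (fun τ => x τ ⬝ᵥ (P *ᵥ x τ))
      (2 * (x t ⬝ᵥ (P *ᵥ (M *ᵥ x t))) + 2 * (x t ⬝ᵥ (P *ᵥ g t))) (Set.Ici 0) t := by
    intro t ht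
    have hsymm : ∀ y, y ⬝ᵥ (P *ᵥ x t) = x t ⬝ᵥ (P *ᵥ y) := fun y => by
      rw [dotProduct_mulVec (x t) P, ← mulVec_transpose, hPs, dotProduct_comm]
    refine (hasDerivWithinAt_dotProduct (hx t ht)
      (hasDerivWithinAt_mulVec P (hx t ht))).congr_deriv ?_
    rw [hsymm, mulVec_add, dotProduct_add]
    ring
  have hV' : ∀ t, 0 ≤ t → 2 * (x t ⬝ᵥ (P *ᵥ (M *ᵥ x t))) + 2 * (x t ⬝ᵥ (P *ᵥ g t))
      ≤ -(κ / D) * (x t ⬝ᵥ (P *ᵥ x t)) + D ^ 2 / κ * b ^ 2 * Real.exp (-(2 * c) * t) := by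
    intro t ht
    have h1 := hdec (x t)
    have h2 := (le_abs_self _).trans (hPD (x t) (g t))
    have h3 := (le_abs_self _).trans (hPD (x t) (x t))
    have h4 : κ / D * (x t ⬝ᵥ (P *ᵥ x t)) ≤ κ * ‖x t‖ ^ 2 := by
      calc κ / D * (x t ⬝ᵥ (P *ᵥ x t)) ≤ κ / D * (D * (‖x t‖ * ‖x t‖)) :=
            mul_le_mul_of_nonneg_left h3 (by positivity)
        _ = _ := by field_simp
    have h5 : ‖g t‖ ^ 2 ≤ b ^ 2 * Real.exp (-(2 * c) * t) := by
      calc ‖g t‖ ^ 2 ≤ (b * Real.exp (-c * t)) ^ 2 := pow_le_pow_left₀ (norm_nonneg _) (hg t ht) 2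
        _ = _ := by rw [mul_pow, ← Real.exp_nat_mul]; congr 2; push_cast; ring
    -- Young's inequality spends half of the dissipation `2 κ ‖x‖²` on the input.
    have h6 : 2 * (D * (‖x t‖ * ‖g t‖)) ≤ κ * ‖x t‖ ^ 2 + D ^ 2 / κ * ‖g t‖ ^ 2 := by
      have : 0 ≤ (κ * ‖x t‖ - D * ‖g t‖) ^ 2 / κ := by positivity
      have e : (κ * ‖x t‖ - D * ‖g t‖) ^ 2 / κ
          = κ * ‖x t‖ ^ 2 + D ^ 2 / κ * ‖g t‖ ^ 2 - 2 * (D * (‖x t‖ * ‖g t‖)) := by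
        field_simp; ring
      linarith
    have h7 := mul_le_mul_of_nonneg_left h5 (show 0 ≤ D ^ 2 / κ by positivity)
    linarith
  have hfin := le_mul_exp_of_deriv_le (γ := 2 * γ) hV hV'
    (fun t _ => (sq_nonneg _).trans (hlow _)) (by positivity) hγ1 hcγ ht
  have h8 := (le_abs_self _).trans (hPD (x 0) (x 0))
  have h9 : x 0 ⬝ᵥ (P *ᵥ x 0) + D ^ 2 / κ * b ^ 2 / (2 * c - 2 * γ) ≤ E * (‖x 0‖ + b) ^ 2 := by
    have e1 : D * (‖x 0‖ * ‖x 0‖) ≤ D * (‖x 0‖ + b) ^ 2 :=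
      mul_le_mul_of_nonneg_left (by nlinarith [norm_nonneg (x 0)]) hD.le
    have e2 : D ^ 2 / κ / (2 * c - 2 * γ) * b ^ 2
        ≤ D ^ 2 / κ / (2 * c - 2 * γ) * (‖x 0‖ + b) ^ 2 :=
      mul_le_mul_of_nonneg_left (by nlinarith [norm_nonneg (x 0)]) (by positivity)
    have e3 : D ^ 2 / κ * b ^ 2 / (2 * c - 2 * γ) = D ^ 2 / κ / (2 * c - 2 * γ) * b ^ 2 := by ring
    rw [e3, hE]
    linarith
  have h10 : ‖x t‖ ^ 2 ≤ (Real.sqrt E * (‖x 0‖ + b) * Real.exp (-γ * t)) ^ 2 := by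
    calc ‖x t‖ ^ 2 ≤ x t ⬝ᵥ (P *ᵥ x t) := hlow _
      _ ≤ _ := hfin
      _ ≤ E * (‖x 0‖ + b) ^ 2 * Real.exp (-(2 * γ) * t) :=
          mul_le_mul_of_nonneg_right h9 (Real.exp_pos _).le
      _ = _ := by
          rw [mul_pow, mul_pow, Real.sq_sqrt hE0.le, ← Real.exp_nat_mul]
          congr 2; push_cast; ring
  exact (pow_le_pow_iff_left₀ (norm_nonneg _) (by positivity) two_ne_zero).1 h10

end ExponentialStability

/-! ### The resource allocation problem and its multiplier. -/

section Optimum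

variable {f : ℝ → ℝ} {a b : ℝ}

/-- The derivative is strongly monotone. -/
theorem HessianBounds.mul_sub_le (hf : HessianBounds f a b) {s t : ℝ} (hst : s ≤ t) :
    a * (t - s) ≤ deriv f t - deriv f s :=
  mul_sub_le_image_sub_of_le_deriv hf.diff_deriv hf.lower hst

theorem HessianBounds.sub_le_mul (hf : HessianBounds f a b) {s t : ℝ} (hst : s ≤ t) :
    deriv f t - deriv f s ≤ b * (t - s) :=
  image_sub_le_mul_sub_of_deriv_le hf.diff_deriv hf.upper hst

theorem HessianBounds.mul_sq_le (hf : HessianBounds f a b) (s t : ℝ) :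
    a * (t - s) ^ 2 ≤ (t - s) * (deriv f t - deriv f s) := by
  rcases le_total s t with h | h
  · nlinarith [hf.mul_sub_le h]
  · nlinarith [hf.mul_sub_le h]

theorem HessianBounds.abs_sub_le (ha : 0 < a) (hf : HessianBounds f a b) (s t : ℝ) :
    |deriv f t - deriv f s| ≤ b * |t - s| := by
  rcases le_total s t with h | h
  · rw [abs_of_nonneg (sub_nonneg.2 h), abs_of_nonneg]
    · exact hf.sub_le_mul h
    · nlinarith [hf.mul_sub_le h]
  · rw [abs_sub_comm, abs_sub_comm t, abs_of_nonneg (sub_nonneg.2 h), abs_of_nonneg]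
    · exact hf.sub_le_mul h
    · nlinarith [hf.mul_sub_le h]

/-- Strong convexity. -/
theorem HessianBounds.quadratic_lower (hf : HessianBounds f a b) (s t : ℝ) :
    f s + deriv f s * (t - s) + a / 2 * (t - s) ^ 2 ≤ f t := by
  -- `g` vanishes at `s`, and strong monotonicity gives `g' ≥ 0` to the right of `s`, `g' ≤ 0` to
  -- the left.
  set g : ℝ → ℝ := fun r => f r - f s - deriv f s * (r - s) - a / 2 * (r - s) ^ 2 with hg
  have hgd : ∀ r, HasDerivAt g (deriv f r - deriv f s - a * (r - s)) r := by
    intro r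
    have h1 : HasDerivAt (fun r : ℝ => r - s) 1 r := (hasDerivAt_id r).sub_const s
    refine ((((hf.diff r).hasDerivAt.sub_const (f s)).sub (h1.const_mul (deriv f s))).sub
      ((h1.pow 2).const_mul (a / 2))).congr_deriv ?_
    push_cast
    ring
  have hgs : g s = 0 := by simp [hg]
  have hc : Continuous g := continuous_iff_continuousAt.2 fun r => (hgd r).continuousAt
  have hpos : 0 ≤ g t := by
    rw [← hgs]
    rcases le_total s t with h | h
    · refine monotoneOn_of_deriv_nonneg (convex_Ici s) hc.continuousOn
        (fun r _ => (hgd r).differentiableAt.differentiableWithinAt) (fun r hr => ?_)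
        Set.self_mem_Ici h h
      rw [interior_Ici, Set.mem_Ioi] at hr
      rw [(hgd r).deriv]
      linarith [hf.mul_sub_le hr.le]
    · refine antitoneOn_of_deriv_nonpos (convex_Iic s) hc.continuousOn
        (fun r _ => (hgd r).differentiableAt.differentiableWithinAt) (fun r hr => ?_)
        h Set.self_mem_Iic h
      rw [interior_Iic, Set.mem_Iio] at hr
      rw [(hgd r).deriv]
      linarith [hf.mul_sub_le hr.le]
  simp only [hg] at hpos
  linarith

/-- The derivative has a continuous, unbounded, strictly increasing inverse. -/
theorem HessianBounds.exists_inverse (ha : 0 < a) (hf : HessianBounds f a b) :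
    ∃ φ : ℝ → ℝ, (∀ l, deriv f (φ l) = l) ∧ Continuous φ ∧ Tendsto φ atTop atTop ∧
      Tendsto φ atBot atBot := by
  have hmono : StrictMono (deriv f) := fun s t hst => by
    nlinarith [hf.mul_sub_le hst.le, mul_pos ha (sub_pos.2 hst)]
  have htop : Tendsto (deriv f) atTop atTop := by
    refine tendsto_atTop_mono' atTop (f₁ := fun t => a * t + deriv f 0) ?_ ?_
    · filter_upwards [eventually_ge_atTop 0] with t ht
      linarith [hf.mul_sub_le ht]
    · exact tendsto_atTop_add_const_right _ _ (tendsto_id.const_mul_atTop ha)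
  have hbot : Tendsto (deriv f) atBot atBot := by
    refine tendsto_atBot_mono' atBot (f₁ := fun t => a * t + deriv f 0) ?_ ?_
    · filter_upwards [eventually_le_atBot 0] with t ht
      linarith [hf.mul_sub_le ht]
    · exact tendsto_atBot_add_const_right _ _ (tendsto_id.const_mul_atBot ha)
  have hsurj : Function.Surjective (deriv f) := hf.diff_deriv.continuous.surjective htop hbot
  let e : ℝ ≃o ℝ := hmono.orderIsoOfSurjective _ hsurj
  exact ⟨e.symm, fun l => e.apply_symm_apply l, e.symm.continuous, e.symm.tendsto_atTop,
    e.symm.tendsto_atBot⟩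

variable {N : ℕ} {F : Fin N → ℝ → ℝ} {d hlo hhi : Fin N → ℝ}

/-- The optimality conditions of the resource allocation problem are solvable. -/
theorem exists_multiplier [Nonempty (Fin N)] (hpos : ∀ i, 0 < hlo i)
    (hF : ∀ i, HessianBounds (F i) (hlo i) (hhi i)) :
    ∃ (y : Fin N → ℝ) (l : ℝ), y ∈ feasible d ∧ ∀ i, deriv (F i) (y i) = l := by
  choose φ hφ hc htop hbot using fun i => (hF i).exists_inverse (hpos i)
  -- With `y i = φ i l` only feasibility remains: one scalar equation in `l`, solved by the
  -- intermediate value theorem. The index set must be nonempty for the sum to diverge.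
  have hsum : Continuous fun l => ∑ i, φ i l := continuous_finsetSum _ fun i _ => hc i
  have h1 : Tendsto (fun l => ∑ i, φ i l) atTop atTop := by
    refine Finset.univ_nonempty.cons_induction (fun i => ?_) (fun i s hi _ ih => ?_)
    · simpa using htop i
    · simp only [Finset.sum_cons]
      exact (htop i).atTop_add_atTop ih
  have h2 : Tendsto (fun l => ∑ i, φ i l) atBot atBot := by
    refine Finset.univ_nonempty.cons_induction (fun i => ?_) (fun i s hi _ ih => ?_)
    · simpa using hbot i
    · simp only [Finset.sum_cons]
      exact (hbot i).atBot_add_atBot ih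
  obtain ⟨l, hl⟩ := hsum.surjective h1 h2 (∑ i, d i)
  exact ⟨fun i => φ i l, l, hl, fun i => hφ i l⟩

/-- The first-order terms share the factor `l` and sum to zero between feasible points, so only the
quadratic gain of strong convexity survives. It yields both optimality and uniqueness. -/
theorem add_sum_sq_le_of_multiplier (hF : ∀ i, HessianBounds (F i) (hlo i) (hhi i))
    {y : Fin N → ℝ} {l : ℝ} (hy : y ∈ feasible d) (hl : ∀ i, deriv (F i) (y i) = l)
    {p : Fin N → ℝ} (hp : p ∈ feasible d) :
    ∑ i, F i (y i) + ∑ i, hlo i / 2 * (p i - y i) ^ 2 ≤ ∑ i, F i (p i) := by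
  have h1 : ∑ i, l * (p i - y i) = 0 := by
    rw [← Finset.mul_sum, Finset.sum_sub_distrib, show ∑ i, p i = ∑ i, d i from hp,
      show ∑ i, y i = ∑ i, d i from hy, sub_self, mul_zero]
  calc _ = ∑ i, (F i (y i) + deriv (F i) (y i) * (p i - y i) + hlo i / 2 * (p i - y i) ^ 2) := by
        simp only [hl, Finset.sum_add_distrib, h1, add_zero]
    _ ≤ _ := Finset.sum_le_sum fun i _ => (hF i).quadratic_lower _ _

theorem isOptimal_of_multiplier (hpos : ∀ i, 0 < hlo i)
    (hF : ∀ i, HessianBounds (F i) (hlo i) (hhi i)) {y : Fin N → ℝ} {l : ℝ} (hy : y ∈ feasible d)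
    (hl : ∀ i, deriv (F i) (y i) = l) : IsOptimal F d y := by
  refine ⟨hy, fun p hp => ?_⟩
  have h1 := add_sum_sq_le_of_multiplier hF hy hl hp
  have h2 : 0 ≤ ∑ i, hlo i / 2 * (p i - y i) ^ 2 :=
    Finset.sum_nonneg fun i _ => mul_nonneg (half_pos (hpos i)).le (sq_nonneg _)
  rw [Set.mem_ofPred_eq]
  linarith

theorem IsOptimal.eq_of_multiplier (hpos : ∀ i, 0 < hlo i)
    (hF : ∀ i, HessianBounds (F i) (hlo i) (hhi i)) {y : Fin N → ℝ} {l : ℝ} (hy : y ∈ feasible d)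
    (hl : ∀ i, deriv (F i) (y i) = l) {p : Fin N → ℝ} (hp : IsOptimal F d p) : p = y := by
  have h1 := add_sum_sq_le_of_multiplier hF hy hl hp.1
  have h2 : ∑ i, F i (p i) ≤ ∑ i, F i (y i) := hp.2 hy
  have h3 : ∀ i ∈ Finset.univ, 0 ≤ hlo i / 2 * (p i - y i) ^ 2 :=
    fun i _ => mul_nonneg (half_pos (hpos i)).le (sq_nonneg _)
  have h4 : ∑ i, hlo i / 2 * (p i - y i) ^ 2 = 0 :=
    le_antisymm (by linarith) (Finset.sum_nonneg h3)
  rw [Finset.sum_eq_zero_iff_of_nonneg h3] at h4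
  ext i
  have := h4 i (Finset.mem_univ _)
  rw [mul_eq_zero, or_iff_right (half_pos (hpos i)).ne', sq_eq_zero_iff, sub_eq_zero] at this
  exact this

end Optimum

/-! ### A strict Lyapunov function for the primal-dual error. -/

section Generator

theorem abs_dotProduct_le {n : ℕ} (x y : Fin n → ℝ) : |x ⬝ᵥ y| ≤ n * (‖x‖ * ‖y‖) := by
  calc |x ⬝ᵥ y| ≤ ∑ i, |x i * y i| := Finset.abs_sum_le_sum_abs _ _
    _ ≤ ∑ _i : Fin n, ‖x‖ * ‖y‖ := Finset.sum_le_sum fun i _ => by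
        rw [abs_mul]
        exact mul_le_mul (norm_le_pi_norm x i) (norm_le_pi_norm y i) (abs_nonneg _) (norm_nonneg _)
    _ = _ := by simp

/-- A positive definite quadratic form is coercive. -/
theorem exists_mul_norm_sq_le {n : ℕ} {M : Matrix (Fin n) (Fin n) ℝ}
    (hM : ∀ x, x ≠ 0 → 0 < x ⬝ᵥ (M *ᵥ x)) : ∃ c : ℝ, 0 < c ∧ ∀ x, c * ‖x‖ ^ 2 ≤ x ⬝ᵥ (M *ᵥ x) := by
  -- The sphere is empty exactly when `n = 0`; otherwise the constant is the minimum on it.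
  rcases (Metric.sphere (0 : Fin n → ℝ) 1).eq_empty_or_nonempty with he | hne
  · refine ⟨1, one_pos, fun x => ?_⟩
    have hx : x = 0 := by
      by_contra hx
      have : ‖x‖⁻¹ • x ∈ Metric.sphere (0 : Fin n → ℝ) 1 := by
        simp [norm_smul, norm_ne_zero_iff.2 hx]
      rw [he] at this
      exact this
    simp [hx]
  · have hcont : Continuous fun x : Fin n → ℝ => x ⬝ᵥ (M *ᵥ x) := by
      simp only [dotProduct, mulVec]
      fun_prop
    obtain ⟨x₀, hx₀, hmin⟩ := (isCompact_sphere (0 : Fin n → ℝ) 1).exists_isMinOn hne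
      hcont.continuousOn
    refine ⟨x₀ ⬝ᵥ (M *ᵥ x₀), hM x₀ (ne_zero_of_mem_unit_sphere ⟨x₀, hx₀⟩), fun x => ?_⟩
    by_cases hx : x = 0
    · simp [hx]
    have hn : ‖x‖ ≠ 0 := norm_ne_zero_iff.2 hx
    have hmem : ‖x‖⁻¹ • x ∈ Metric.sphere (0 : Fin n → ℝ) 1 := by
      simp [norm_smul, hn]
    have h1 : x₀ ⬝ᵥ (M *ᵥ x₀) ≤ (‖x‖⁻¹ • x) ⬝ᵥ (M *ᵥ (‖x‖⁻¹ • x)) := hmin hmem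
    rw [mulVec_smul, smul_dotProduct, dotProduct_smul, smul_eq_mul, smul_eq_mul] at h1
    calc _ ≤ ‖x‖⁻¹ * (‖x‖⁻¹ * (x ⬝ᵥ (M *ᵥ x))) * ‖x‖ ^ 2 :=
          mul_le_mul_of_nonneg_right h1 (sq_nonneg _)
      _ = _ := by field_simp

/-- The weights of the cross terms in the Lyapunov function of the generator. -/
theorem exists_lyapunov_weights {h c D : ℝ} (hh : 0 < h) (hc : 0 < c) (hD : 1 ≤ D) :
    ∃ e₁ e₂ κ : ℝ, 0 < e₁ ∧ 0 < e₂ ∧ 0 < κ ∧ e₁ * D ≤ 1 / 4 ∧ e₂ * D ≤ 1 / 4 ∧ ∀ a b e : ℝ,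
      -h * a ^ 2 + e₁ * (-b ^ 2 + D * (a * b + a * e + a ^ 2))
        + e₂ * (-c * e ^ 2 + D * (b * e + a * e + b ^ 2)) ≤ -κ * (a ^ 2 + b ^ 2 + e ^ 2) := by
  have hD0 : 0 < D := by linarith
  -- `δ` is the ratio `e₂ / e₁`, small enough that the `b ^ 2` produced by the second cross term
  -- costs at most a quarter of the `-b ^ 2` gained from the first.
  set δ : ℝ := c / (4 * D * (D + c)) with hδ
  have hδ0 : 0 < δ := by positivity
  have hδ1 : δ ≤ 1 / 4 := by
    rw [hδ, div_le_iff₀ (by positivity)]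
    nlinarith [mul_pos hD0 hc]
  have hδ2 : δ * (D + D ^ 2 / (2 * c)) ≤ 1 / 4 := by
    rw [hδ]
    have : c / (4 * D * (D + c)) * (D + D ^ 2 / (2 * c)) = (2 * c + D) / (8 * (D + c)) := by
      field_simp
      ring
    rw [this, div_le_iff₀ (by positivity)]
    linarith
  -- `K` collects the coefficients of `a ^ 2` left by Young's inequality; `ε = e₁` is then small
  -- enough for `-h * a ^ 2` to pay for them.
  set K : ℝ := D ^ 2 + (1 + δ) ^ 2 * D ^ 2 / (δ * c) + D with hK
  have hK0 : 0 < K := by positivity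
  set ε : ℝ := min (h / (2 * K)) (1 / (4 * D)) with hε
  have hε0 : 0 < ε := by positivity
  have hεK : ε * K ≤ h / 2 := by
    calc ε * K ≤ h / (2 * K) * K := mul_le_mul_of_nonneg_right (min_le_left _ _) hK0.le
      _ = h / 2 := by field_simp
  have hεD : ε * D ≤ 1 / 4 := by
    calc ε * D ≤ 1 / (4 * D) * D := mul_le_mul_of_nonneg_right (min_le_right _ _) hD0.le
      _ = 1 / 4 := by field_simp
  set κ : ℝ := min (h / 2) (min (ε / 2) (ε * (δ * c / 4))) with hκ
  have hκ1 : κ ≤ h / 2 := min_le_left _ _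
  have hκ2 : κ ≤ ε / 2 := (min_le_right _ _).trans (min_le_left _ _)
  have hκ3 : κ ≤ ε * (δ * c / 4) := (min_le_right _ _).trans (min_le_right _ _)
  refine ⟨ε, ε * δ, κ, hε0, by positivity, by positivity, hεD, by nlinarith, fun a b e => ?_⟩
  have y1 : D * (b * e) ≤ c / 2 * e ^ 2 + D ^ 2 / (2 * c) * b ^ 2 := by
    have : 0 ≤ (c * e - D * b) ^ 2 / (2 * c) := by positivity
    have e1 : (c * e - D * b) ^ 2 / (2 * c)
        = c / 2 * e ^ 2 + D ^ 2 / (2 * c) * b ^ 2 - D * (b * e) := by field_simp; ring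
    linarith
  have y2 : D * (a * b) ≤ 1 / 4 * b ^ 2 + D ^ 2 * a ^ 2 := by
    nlinarith [sq_nonneg (b / 2 - D * a)]
  have y3 : (1 + δ) * D * (a * e)
      ≤ δ * c / 4 * e ^ 2 + (1 + δ) ^ 2 * D ^ 2 / (δ * c) * a ^ 2 := by
    have : 0 ≤ (δ * c * e - 2 * (1 + δ) * D * a) ^ 2 / (4 * (δ * c)) := by positivity
    have e1 : (δ * c * e - 2 * (1 + δ) * D * a) ^ 2 / (4 * (δ * c))
        = δ * c / 4 * e ^ 2 + (1 + δ) ^ 2 * D ^ 2 / (δ * c) * a ^ 2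
          - (1 + δ) * D * (a * e) := by field_simp; ring
    linarith
  have y4 := mul_le_mul_of_nonneg_left y1 hδ0.le
  have y5 := mul_le_mul_of_nonneg_right hδ2 (sq_nonneg b)
  have y6 : -b ^ 2 + D * (a * b + a * e + a ^ 2) + δ * (-c * e ^ 2 + D * (b * e + a * e + b ^ 2))
      ≤ K * a ^ 2 - 1 / 2 * b ^ 2 - δ * c / 4 * e ^ 2 := by
    rw [hK]
    linarith
  have y7 := mul_le_mul_of_nonneg_left y6 hε0.le
  have y8 := mul_le_mul_of_nonneg_right hεK (sq_nonneg a)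
  have y9 := mul_le_mul_of_nonneg_right hκ1 (sq_nonneg a)
  have y10 := mul_le_mul_of_nonneg_right hκ2 (sq_nonneg b)
  have y11 := mul_le_mul_of_nonneg_right hκ3 (sq_nonneg e)
  linarith

/-- The pointwise dissipation estimate behind the stability of the primal-dual generator. -/
theorem primalDual_dissipation_le {N : ℕ} {L : Matrix (Fin N) (Fin N) ℝ}
    (hL0 : ∀ x, 0 ≤ x ⬝ᵥ (L *ᵥ x)) {c D₀ D h H e₁ e₂ : ℝ} (hD₀ : 0 ≤ D₀) (hH : 0 ≤ H)
    (hLD₀ : ∀ x y, |x ⬝ᵥ (L *ᵥ y)| ≤ D₀ * (‖x‖ * ‖y‖)) (hD : N * H + D₀ + N ≤ D)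
    (he₁ : 0 ≤ e₁) (he₂ : 0 ≤ e₂) {p l w φ : Fin N → ℝ}
    (hw : c * ‖w‖ ^ 2 ≤ w ⬝ᵥ (L *ᵥ w)) (hφ : h * ‖p‖ ^ 2 ≤ p ⬝ᵥ φ) (hφH : ‖φ‖ ≤ H * ‖p‖) :
    -(p ⬝ᵥ φ) - l ⬝ᵥ (L *ᵥ l)
        + e₁ * (-(l ⬝ᵥ l) + φ ⬝ᵥ l + p ⬝ᵥ (L *ᵥ l) + p ⬝ᵥ (L *ᵥ w) + p ⬝ᵥ p)
        + e₂ * (-(w ⬝ᵥ (L *ᵥ w)) - l ⬝ᵥ (L *ᵥ w) - p ⬝ᵥ w + l ⬝ᵥ (L *ᵥ l))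
      ≤ -h * ‖p‖ ^ 2 + e₁ * (-‖l‖ ^ 2 + D * (‖p‖ * ‖l‖ + ‖p‖ * ‖w‖ + ‖p‖ ^ 2))
        + e₂ * (-c * ‖w‖ ^ 2 + D * (‖l‖ * ‖w‖ + ‖p‖ * ‖w‖ + ‖l‖ ^ 2)) := by
  -- Factors `N` come from bounding dot products by sup norms. The term `-(l ⬝ᵥ (L *ᵥ l))` is merely
  -- discarded as nonpositive.
  have hNH : 0 ≤ N * H := by positivity
  have h1 : φ ⬝ᵥ l ≤ N * H * (‖p‖ * ‖l‖) := by
    refine ((le_abs_self _).trans (abs_dotProduct_le _ _)).trans ?_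
    have := mul_le_mul_of_nonneg_right hφH (norm_nonneg l)
    calc (N : ℝ) * (‖φ‖ * ‖l‖) ≤ N * (H * ‖p‖ * ‖l‖) :=
          mul_le_mul_of_nonneg_left this (by positivity)
      _ = _ := by ring
  have h2 := (le_abs_self _).trans (hLD₀ p l)
  have h3 := (le_abs_self _).trans (hLD₀ p w)
  have h4 := (le_abs_self _).trans (abs_dotProduct_le p p)
  have h5 := (neg_le_abs _).trans (hLD₀ l w)
  have h6 := (neg_le_abs _).trans (abs_dotProduct_le p w)
  have h7 := (le_abs_self _).trans (hLD₀ l l)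
  have h9 := norm_sq_le_dotProduct_self l
  have h10 := hL0 l
  have n1 : 0 ≤ ‖p‖ * ‖l‖ := by positivity
  have n2 : 0 ≤ ‖p‖ * ‖w‖ := by positivity
  have n3 : 0 ≤ ‖l‖ * ‖w‖ := by positivity
  have n4 : 0 ≤ ‖p‖ * ‖p‖ := by positivity
  have n5 : 0 ≤ ‖l‖ * ‖l‖ := by positivity
  have hN : (0 : ℝ) ≤ N := by positivity
  have g1 : -(l ⬝ᵥ l) + φ ⬝ᵥ l + p ⬝ᵥ (L *ᵥ l) + p ⬝ᵥ (L *ᵥ w) + p ⬝ᵥ p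
      ≤ -‖l‖ ^ 2 + D * (‖p‖ * ‖l‖ + ‖p‖ * ‖w‖ + ‖p‖ ^ 2) := by
    have a1 : N * H * (‖p‖ * ‖l‖) + D₀ * (‖p‖ * ‖l‖) ≤ D * (‖p‖ * ‖l‖) := by
      rw [← add_mul]; exact mul_le_mul_of_nonneg_right (by linarith) n1
    have a2 : D₀ * (‖p‖ * ‖w‖) ≤ D * (‖p‖ * ‖w‖) :=
      mul_le_mul_of_nonneg_right (by linarith) n2
    have a3 : N * (‖p‖ * ‖p‖) ≤ D * (‖p‖ * ‖p‖) :=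
      mul_le_mul_of_nonneg_right (by linarith) n4
    linarith only [a1, a2, a3, h1, h2, h3, h4, h9]
  have g2 : -(w ⬝ᵥ (L *ᵥ w)) - l ⬝ᵥ (L *ᵥ w) - p ⬝ᵥ w + l ⬝ᵥ (L *ᵥ l)
      ≤ -c * ‖w‖ ^ 2 + D * (‖l‖ * ‖w‖ + ‖p‖ * ‖w‖ + ‖l‖ ^ 2) := by
    have a1 : D₀ * (‖l‖ * ‖w‖) ≤ D * (‖l‖ * ‖w‖) :=
      mul_le_mul_of_nonneg_right (by linarith) n3
    have a2 : N * (‖p‖ * ‖w‖) ≤ D * (‖p‖ * ‖w‖) :=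
      mul_le_mul_of_nonneg_right (by linarith) n2
    have a3 : D₀ * (‖l‖ * ‖l‖) ≤ D * (‖l‖ * ‖l‖) :=
      mul_le_mul_of_nonneg_right (by linarith) n5
    linarith only [a1, a2, a3, h5, h6, h7, hw]
  have g3 := mul_le_mul_of_nonneg_left g1 he₁
  have g4 := mul_le_mul_of_nonneg_left g2 he₂
  linarith only [g3, g4, hφ, h10]

/-- Exponential stability of the error dynamics of the primal-dual generator. -/
theorem exists_exp_bound_primalDual {N : ℕ} {L : Matrix (Fin N) (Fin N) ℝ} (hLs : Lᵀ = L)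
    (hL0 : ∀ x, 0 ≤ x ⬝ᵥ (L *ᵥ x)) {c : ℝ} (hc : 0 < c)
    (hLc : ∀ x, ∑ i, x i = 0 → c * ‖x‖ ^ 2 ≤ x ⬝ᵥ (L *ᵥ x)) (hL1 : ∀ x, ∑ i, (L *ᵥ x) i = 0)
    {h H : ℝ} (hh : 0 < h) (hH : 0 ≤ H) :
    ∃ γ C : ℝ, 0 < γ ∧ 0 < C ∧ ∀ p l w φ : ℝ → Fin N → ℝ,
      (∀ t, 0 ≤ t → HasDerivWithinAt p (-φ t + l t) (Set.Ici 0) t) →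
      (∀ t, 0 ≤ t → HasDerivWithinAt l (-(L *ᵥ l t) - L *ᵥ w t - p t) (Set.Ici 0) t) →
      (∀ t, 0 ≤ t → HasDerivWithinAt w (L *ᵥ l t) (Set.Ici 0) t) →
      (∀ t, h * ‖p t‖ ^ 2 ≤ p t ⬝ᵥ φ t) → (∀ t, ‖φ t‖ ≤ H * ‖p t‖) → ∑ i, w 0 i = 0 →
      ∀ t, 0 ≤ t → ‖p t‖ ≤ C * (‖p 0‖ + ‖l 0‖ + ‖w 0‖) * Real.exp (-γ * t) := by
  obtain ⟨D₀, hD₀, hLD₀⟩ := exists_abs_dotProduct_mulVec_le L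
  set D : ℝ := N * H + D₀ + N + 1 with hDdef
  have hNH : 0 ≤ N * H := by positivity
  have hD1 : 1 ≤ D := by
    have : (0 : ℝ) ≤ N := by positivity
    linarith
  have hD0 : 0 < D := by linarith
  obtain ⟨e₁, e₂, κ, he₁, he₂, hκ, hd₁, hd₂, hweights⟩ := exists_lyapunov_weights hh hc hD1
  refine ⟨κ / D / 2, 2 * D, by positivity, by positivity,
    fun p l w φ hp hl hw hφ hφH hw0 t ht => ?_⟩
  have hsymm : ∀ x y : Fin N → ℝ, (L *ᵥ x) ⬝ᵥ y = x ⬝ᵥ (L *ᵥ y) := fun x y => by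
    rw [dotProduct_mulVec, ← mulVec_transpose, hLs]
  -- The sum of `w` is conserved, so `w` stays where `L` is coercive.
  have hsum : ∀ t, 0 ≤ t → ∑ i, w t i = 0 := by
    intro t ht
    have hd : ∀ τ, 0 ≤ τ → HasDerivWithinAt (fun τ => ∑ i, w τ i) 0 (Set.Ici 0) τ := by
      intro τ hτ
      have := HasDerivWithinAt.fun_sum (u := Finset.univ) fun i _ =>
        (hasDerivWithinAt_pi.1 (hw τ hτ)) i
      rwa [hL1] at this
    rw [← hw0]
    exact constant_of_has_deriv_right_zero (a := 0) (b := t)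
      (fun τ hτ => (hd τ hτ.1).continuousWithinAt.mono Set.Icc_subset_Ici_self)
      (fun τ hτ => (hd τ hτ.1).mono (Set.Ici_subset_Ici.2 hτ.1)) t ⟨ht, le_rfl⟩
  -- The derivative of `-(p ⬝ᵥ l)` supplies `-(l ⬝ᵥ l)`, and that of `l ⬝ᵥ w` supplies `-(w ⬝ᵥ (L *ᵥ
  -- w))`: the dissipation missing from the plain energy.
  set V : ℝ → ℝ := fun t => 1 / 2 * (p t ⬝ᵥ p t + l t ⬝ᵥ l t + w t ⬝ᵥ w t)
    - e₁ * (p t ⬝ᵥ l t) + e₂ * (l t ⬝ᵥ w t) with hV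
  set V' : ℝ → ℝ := fun t => -(p t ⬝ᵥ φ t) - l t ⬝ᵥ (L *ᵥ l t)
    + e₁ * (-(l t ⬝ᵥ l t) + φ t ⬝ᵥ l t + p t ⬝ᵥ (L *ᵥ l t) + p t ⬝ᵥ (L *ᵥ w t) + p t ⬝ᵥ p t)
    + e₂ * (-(w t ⬝ᵥ (L *ᵥ w t)) - l t ⬝ᵥ (L *ᵥ w t) - p t ⬝ᵥ w t + l t ⬝ᵥ (L *ᵥ l t)) with hV'
  have hVd : ∀ t, 0 ≤ t → HasDerivWithinAt V (V' t) (Set.Ici 0) t := by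
    intro t ht
    have d1 := hasDerivWithinAt_dotProduct (hp t ht) (hp t ht)
    have d2 := hasDerivWithinAt_dotProduct (hl t ht) (hl t ht)
    have d3 := hasDerivWithinAt_dotProduct (hw t ht) (hw t ht)
    have d4 := hasDerivWithinAt_dotProduct (hp t ht) (hl t ht)
    have d5 := hasDerivWithinAt_dotProduct (hl t ht) (hw t ht)
    refine (((((d1.add d2).add d3).const_mul (1 / 2)).sub (d4.const_mul e₁)).add
      (d5.const_mul e₂)).congr_deriv ?_
    simp only [hV', add_dotProduct, sub_dotProduct, neg_dotProduct, dotProduct_add,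
      dotProduct_sub, dotProduct_neg, hsymm]
    rw [dotProduct_comm (φ t) (p t), dotProduct_comm (l t) (p t),
      show w t ⬝ᵥ (L *ᵥ l t) = l t ⬝ᵥ (L *ᵥ w t) by rw [← hsymm, dotProduct_comm]]
    ring
  have bN : ∀ x y : Fin N → ℝ, |x ⬝ᵥ y| ≤ D * (‖x‖ * ‖y‖) := fun x y =>
    (abs_dotProduct_le x y).trans
      (mul_le_mul_of_nonneg_right (by linarith) (by positivity))
  set s : ℝ → ℝ := fun t => ‖p t‖ ^ 2 + ‖l t‖ ^ 2 + ‖w t‖ ^ 2 with hs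
  have cross₁ : ∀ t, |e₁ * (p t ⬝ᵥ l t)| ≤ 1 / 8 * (‖p t‖ ^ 2 + ‖l t‖ ^ 2) := by
    intro t
    rw [abs_mul, abs_of_pos he₁]
    have h1 := mul_le_mul_of_nonneg_left (bN (p t) (l t)) he₁.le
    have h2 : 0 ≤ ‖p t‖ * ‖l t‖ := by positivity
    nlinarith [mul_le_mul_of_nonneg_right hd₁ h2, sq_nonneg (‖p t‖ - ‖l t‖)]
  have cross₂ : ∀ t, |e₂ * (l t ⬝ᵥ w t)| ≤ 1 / 8 * (‖l t‖ ^ 2 + ‖w t‖ ^ 2) := by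
    intro t
    rw [abs_mul, abs_of_pos he₂]
    have h1 := mul_le_mul_of_nonneg_left (bN (l t) (w t)) he₂.le
    have h2 : 0 ≤ ‖l t‖ * ‖w t‖ := by positivity
    nlinarith [mul_le_mul_of_nonneg_right hd₂ h2, sq_nonneg (‖l t‖ - ‖w t‖)]
  have hlow : ∀ t, 1 / 4 * s t ≤ V t := by
    intro t
    have h1 := (abs_le.1 (cross₁ t)).2
    have h2 := (abs_le.1 (cross₂ t)).1
    have h3 := norm_sq_le_dotProduct_self (p t)
    have h4 := norm_sq_le_dotProduct_self (l t)
    have h5 := norm_sq_le_dotProduct_self (w t)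
    simp only [hV, hs]
    linarith only [sq_nonneg ‖p t‖, sq_nonneg ‖w t‖, h1, h2, h3, h4, h5]
  have hup : ∀ t, V t ≤ D * s t := by
    intro t
    have h1 := (abs_le.1 (cross₁ t)).1
    have h2 := (abs_le.1 (cross₂ t)).2
    have h3 := (le_abs_self _).trans (bN (p t) (p t))
    have h4 := (le_abs_self _).trans (bN (l t) (l t))
    have h5 := (le_abs_self _).trans (bN (w t) (w t))
    have h6 : s t ≤ D * s t := le_mul_of_one_le_left (by positivity) hD1
    have h7 : 1 / 2 * (p t ⬝ᵥ p t + l t ⬝ᵥ l t + w t ⬝ᵥ w t) ≤ 1 / 2 * (D * s t) := by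
      simp only [hs]
      linarith only [h3, h4, h5]
    have h8 : 1 / 8 * (‖p t‖ ^ 2 + ‖l t‖ ^ 2) + 1 / 8 * (‖l t‖ ^ 2 + ‖w t‖ ^ 2)
        ≤ 1 / 4 * s t := by
      simp only [hs]
      linarith only [sq_nonneg ‖p t‖, sq_nonneg ‖w t‖]
    have h9 : 0 ≤ s t := by positivity
    simp only [hV]
    linarith only [h1, h2, h6, h7, h8, h9]
  -- There is no forcing; the rate `κ / D + 1` is a dummy that only has to exceed `κ / D`.
  have hdec : ∀ t, 0 ≤ t → V' t ≤ -(κ / D) * V t + 0 * Real.exp (-(κ / D + 1) * t) := by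
    intro t ht
    have w1 := hweights ‖p t‖ ‖l t‖ ‖w t‖
    have w2 := primalDual_dissipation_le hL0 hD₀ hH hLD₀ (show N * H + D₀ + N ≤ D by linarith)
      he₁.le he₂.le (l := l t) (hLc (w t) (hsum t ht)) (hφ t) (hφH t)
    have g5 : κ / D * V t ≤ κ * s t := by
      calc κ / D * V t ≤ κ / D * (D * s t) := mul_le_mul_of_nonneg_left (hup t) (by positivity)
        _ = _ := by field_simp
    simp only [hs] at g5
    rw [zero_mul, add_zero, neg_mul]
    simp only [hV']
    linarith only [w1, w2, g5]
  have hfin := le_mul_exp_of_deriv_le (γ := κ / D) hVd hdec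
    (fun t _ => le_trans (by positivity) (hlow t)) le_rfl le_rfl (by linarith) ht
  rw [zero_div, add_zero] at hfin
  have hp0 : ‖p t‖ ^ 2 ≤ (2 * D * (‖p 0‖ + ‖l 0‖ + ‖w 0‖) * Real.exp (-(κ / D / 2) * t)) ^ 2 := by
    have h1 : s 0 ≤ (‖p 0‖ + ‖l 0‖ + ‖w 0‖) ^ 2 := by
      have n1 : 0 ≤ ‖p 0‖ * ‖l 0‖ := by positivity
      have n2 : 0 ≤ ‖p 0‖ * ‖w 0‖ := by positivity
      have n3 : 0 ≤ ‖l 0‖ * ‖w 0‖ := by positivity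
      simp only [hs]
      nlinarith
    have h2 : 4 * V 0 ≤ (2 * D) ^ 2 * (‖p 0‖ + ‖l 0‖ + ‖w 0‖) ^ 2 := by
      calc 4 * V 0 ≤ 4 * (D * s 0) := by linarith [hup 0]
        _ ≤ 4 * (D * (‖p 0‖ + ‖l 0‖ + ‖w 0‖) ^ 2) := by gcongr
        _ ≤ 4 * (D * D * (‖p 0‖ + ‖l 0‖ + ‖w 0‖) ^ 2) := by
          gcongr
          exact le_mul_of_one_le_left hD0.le hD1
        _ = _ := by ring
    have h3 : ‖p t‖ ^ 2 ≤ s t := by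
      simp only [hs]
      nlinarith [sq_nonneg ‖l t‖, sq_nonneg ‖w t‖]
    calc ‖p t‖ ^ 2 ≤ 4 * V t := by linarith [hlow t]
      _ ≤ 4 * V 0 * Real.exp (-(κ / D) * t) := by linarith
      _ ≤ (2 * D) ^ 2 * (‖p 0‖ + ‖l 0‖ + ‖w 0‖) ^ 2 * Real.exp (-(κ / D) * t) :=
        mul_le_mul_of_nonneg_right h2 (Real.exp_pos _).le
      _ = _ := by
        rw [show -(κ / D) * t = (2 : ℕ) * (-(κ / D / 2) * t) by push_cast; ring, Real.exp_nat_mul]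
        ring
  exact (pow_le_pow_iff_left₀ (norm_nonneg _) (by positivity) two_ne_zero).1 hp0

end Generator

/-! ### The Laplacian of a connected weighted graph. -/

section Graph

variable {N : ℕ} (𝒢 : WeightedGraph N)

/-- The weighted Laplacian. -/
def WeightedGraph.laplacian : Matrix (Fin N) (Fin N) ℝ :=
  Matrix.diagonal (fun i => ∑ j, 𝒢.a i j) - 𝒢.a

theorem WeightedGraph.laplacian_mulVec (x : Fin N → ℝ) : 𝒢.laplacian *ᵥ x = 𝒢.diffusion x := by
  ext i
  rw [laplacian, sub_mulVec, Pi.sub_apply, mulVec_diagonal, diffusion, Finset.sum_mul, mulVec,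
    dotProduct, ← Finset.sum_sub_distrib]
  exact Finset.sum_congr rfl fun j _ => by ring

theorem WeightedGraph.laplacian_transpose : 𝒢.laplacianᵀ = 𝒢.laplacian := by
  rw [laplacian, transpose_sub, diagonal_transpose]
  congr 1
  ext i j
  exact 𝒢.symm j i

/-- The summand is antisymmetric in `(i, j)`. This is what conserves the sum of `v`. -/
theorem WeightedGraph.sum_laplacian_mulVec (x : Fin N → ℝ) : ∑ i, (𝒢.laplacian *ᵥ x) i = 0 := by
  simp only [laplacian_mulVec, diffusion]
  have h : ∑ i, ∑ j, 𝒢.a i j * (x i - x j) = -∑ i, ∑ j, 𝒢.a i j * (x i - x j) := by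
    rw [← Finset.sum_neg_distrib, Finset.sum_comm]
    refine Finset.sum_congr rfl fun i _ => ?_
    rw [← Finset.sum_neg_distrib]
    exact Finset.sum_congr rfl fun j _ => by rw [𝒢.symm j i]; ring
  linarith

theorem WeightedGraph.two_mul_dotProduct_laplacian (x : Fin N → ℝ) :
    2 * (x ⬝ᵥ (𝒢.laplacian *ᵥ x)) = ∑ i, ∑ j, 𝒢.a i j * (x i - x j) ^ 2 := by
  have h1 : x ⬝ᵥ (𝒢.laplacian *ᵥ x) = ∑ i, ∑ j, 𝒢.a i j * (x i * (x i - x j)) := by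
    rw [laplacian_mulVec, dotProduct]
    refine Finset.sum_congr rfl fun i _ => ?_
    rw [diffusion, Finset.mul_sum]
    exact Finset.sum_congr rfl fun j _ => by ring
  have h2 : x ⬝ᵥ (𝒢.laplacian *ᵥ x) = ∑ i, ∑ j, 𝒢.a i j * (x j * (x j - x i)) := by
    rw [h1, Finset.sum_comm]
    exact Finset.sum_congr rfl fun i _ => Finset.sum_congr rfl fun j _ => by rw [𝒢.symm]
  rw [two_mul]
  nth_rewrite 1 [h1]
  rw [h2, ← Finset.sum_add_distrib]
  refine Finset.sum_congr rfl fun i _ => ?_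
  rw [← Finset.sum_add_distrib]
  exact Finset.sum_congr rfl fun j _ => by ring

theorem WeightedGraph.dotProduct_laplacian_nonneg (x : Fin N → ℝ) :
    0 ≤ x ⬝ᵥ (𝒢.laplacian *ᵥ x) := by
  have := 𝒢.two_mul_dotProduct_laplacian x
  have h : 0 ≤ ∑ i, ∑ j, 𝒢.a i j * (x i - x j) ^ 2 :=
    Finset.sum_nonneg fun i _ => Finset.sum_nonneg fun j _ =>
      mul_nonneg (𝒢.nonneg i j) (sq_nonneg _)
  linarith

/-- Every term of the sum of squares vanishes, so `x` agrees across edges and hence along walks. -/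
theorem WeightedGraph.eq_of_dotProduct_laplacian_eq_zero (hconn : 𝒢.toSimpleGraph.Connected)
    {x : Fin N → ℝ} (hx : x ⬝ᵥ (𝒢.laplacian *ᵥ x) = 0) (i j : Fin N) : x i = x j := by
  have h := 𝒢.two_mul_dotProduct_laplacian x
  rw [hx, mul_zero, eq_comm, Finset.sum_eq_zero_iff_of_nonneg fun i _ =>
    Finset.sum_nonneg fun j _ => mul_nonneg (𝒢.nonneg i j) (sq_nonneg _)] at h
  have hadj : ∀ i j, 𝒢.toSimpleGraph.Adj i j → x i = x j := by
    intro i j hij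
    have h1 := h i (Finset.mem_univ _)
    rw [Finset.sum_eq_zero_iff_of_nonneg fun j _ => mul_nonneg (𝒢.nonneg i j) (sq_nonneg _)] at h1
    have h2 := h1 j (Finset.mem_univ _)
    have h3 : 0 < 𝒢.a i j := hij
    rw [mul_eq_zero, or_iff_right h3.ne', sq_eq_zero_iff, sub_eq_zero] at h2
    exact h2
  obtain ⟨w⟩ := hconn.preconnected i j
  induction w with
  | nil => rfl
  | cons hij _ ih => exact (hadj _ _ hij).trans ih

theorem dotProduct_ones_mulVec (x : Fin N → ℝ) :
    x ⬝ᵥ ((Matrix.of fun _ _ => (1 : ℝ)) *ᵥ x) = (∑ i, x i) ^ 2 := by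
  simp [dotProduct, mulVec, sq, Finset.sum_mul]

/-- The Laplacian form vanishes only on constants, where the all-ones form is positive. This one
definite matrix serves both for coercivity on sum-zero vectors and for solving Laplacian equations.
-/
theorem WeightedGraph.laplacian_add_ones_pos (hconn : 𝒢.toSimpleGraph.Connected) (x : Fin N → ℝ)
    (hx : x ≠ 0) : 0 < x ⬝ᵥ ((𝒢.laplacian + Matrix.of fun _ _ => (1 : ℝ)) *ᵥ x) := by
  rw [add_mulVec, dotProduct_add, dotProduct_ones_mulVec]
  refine lt_of_le_of_ne (add_nonneg (𝒢.dotProduct_laplacian_nonneg x) (sq_nonneg _)) fun h => hx ?_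
  have h1 := 𝒢.dotProduct_laplacian_nonneg x
  have h2 := sq_nonneg (∑ i, x i)
  have h3 : ∑ i, x i = 0 := by rw [← sq_eq_zero_iff]; linarith
  have h4 := 𝒢.eq_of_dotProduct_laplacian_eq_zero hconn (x := x) (by linarith)
  ext i
  have h5 : ∑ j, x j = N * x i := by
    rw [Finset.sum_congr rfl fun j _ => h4 j i]; simp
  have : (N : ℝ) ≠ 0 := by
    have := i.pos
    exact_mod_cast this.ne'
  rw [h3, eq_comm, mul_eq_zero, or_iff_right this] at h5
  exact h5

theorem WeightedGraph.exists_laplacian_coercive (hconn : 𝒢.toSimpleGraph.Connected) :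
    ∃ c : ℝ, 0 < c ∧ ∀ x : Fin N → ℝ, ∑ i, x i = 0 →
      c * ‖x‖ ^ 2 ≤ x ⬝ᵥ (𝒢.laplacian *ᵥ x) := by
  obtain ⟨c, hc, h⟩ := exists_mul_norm_sq_le (𝒢.laplacian_add_ones_pos hconn)
  refine ⟨c, hc, fun x hx => ?_⟩
  have := h x
  rw [add_mulVec, dotProduct_add, dotProduct_ones_mulVec, hx] at this
  simpa using this

/-- Solve with the all-ones matrix added; summing coordinates shows `∑ v = 0`, so the added part
contributes nothing. -/
theorem WeightedGraph.exists_laplacian_mulVec_eq (hconn : 𝒢.toSimpleGraph.Connected)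
    {r : Fin N → ℝ} (hr : ∑ i, r i = 0) : ∃ v, 𝒢.laplacian *ᵥ v = r := by
  set M := 𝒢.laplacian + Matrix.of fun _ _ => (1 : ℝ) with hM
  have hinj : Function.Injective M.mulVecLin := by
    rw [← LinearMap.ker_eq_bot, LinearMap.ker_eq_bot']
    intro x hx
    by_contra h0
    have := 𝒢.laplacian_add_ones_pos hconn x h0
    rw [mulVecLin_apply] at hx
    rw [hx, dotProduct_zero] at this
    exact lt_irrefl _ this
  obtain ⟨v, hv⟩ := LinearMap.injective_iff_surjective.1 hinj r
  rw [mulVecLin_apply, hM, add_mulVec] at hv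
  have hones : ∀ i, ((Matrix.of fun (_ _ : Fin N) => (1 : ℝ)) *ᵥ v) i = ∑ j, v j := fun i => by
    simp [mulVec, dotProduct]
  have h1 : (N : ℝ) * ∑ j, v j = 0 := by
    have := congrArg (fun x : Fin N → ℝ => ∑ i, x i) hv
    simpa [Finset.sum_add_distrib, 𝒢.sum_laplacian_mulVec, hones, hr] using this
  refine ⟨v, ?_⟩
  rw [← hv]
  ext i
  have hN : (N : ℝ) ≠ 0 := by
    have := i.pos
    exact_mod_cast this.ne'
  rw [mul_eq_zero, or_iff_right hN] at h1
  rw [Pi.add_apply, hones, h1, add_zero]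

theorem WeightedGraph.laplacian_mulVec_const (r : ℝ) : 𝒢.laplacian *ᵥ (fun _ => r) = 0 := by
  ext i
  simp [laplacian_mulVec, diffusion]

end Graph

/-! ### Convergence of the optimal signal generator. -/

section OptimalSignalGenerator

variable {N : ℕ} {f : Fin N → ℝ → ℝ} {d hlo hhi y : Fin N → ℝ} {l : ℝ}

/-- The optimal signal generator converges exponentially to the optimum. -/
theorem exists_exp_bound_generator (𝒢 : WeightedGraph N) (hconn : 𝒢.toSimpleGraph.Connected)
    (hpos : ∀ i, 0 < hlo i) (hf : ∀ i, HessianBounds (f i) (hlo i) (hhi i))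
    (hy : y ∈ feasible d) (hl : ∀ i, deriv (f i) (y i) = l) :
    ∃ γ C : ℝ, 0 < γ ∧ 0 < C ∧ ∀ z lam v : ℝ → Fin N → ℝ,
      (∀ t, 0 ≤ t → ∀ i, HasDerivWithinAt (fun τ => z τ i)
        (-deriv (f i) (z t i) + lam t i) (Set.Ici 0) t) →
      (∀ t, 0 ≤ t → ∀ i, HasDerivWithinAt (fun τ => lam τ i)
        (-𝒢.diffusion (lam t) i - 𝒢.diffusion (v t) i + d i - z t i) (Set.Ici 0) t) →
      (∀ t, 0 ≤ t → ∀ i, HasDerivWithinAt (fun τ => v τ i)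
        (𝒢.diffusion (lam t) i) (Set.Ici 0) t) →
      ∀ t, 0 ≤ t →
        ‖z t - y‖ ≤ C * (1 + (‖z 0‖ + ‖lam 0‖ + ‖v 0‖)) * Real.exp (-γ * t) := by
  have := hconn.nonempty
  have hN : (0 : ℝ) < N := by exact_mod_cast (Classical.arbitrary (Fin N)).pos
  obtain ⟨c, hc, hLc⟩ := 𝒢.exists_laplacian_coercive hconn
  obtain ⟨i₀, hi₀⟩ := Finite.exists_min hlo
  obtain ⟨i₁, hi₁⟩ := Finite.exists_max hhi
  have hle : ∀ i, hlo i ≤ hhi i := fun i => ((hf i).lower 0).trans ((hf i).upper 0)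
  have hH : 0 < hhi i₁ := (hpos i₁).trans_le (hle i₁)
  obtain ⟨γ, C, hγ, hC, hbound⟩ := exists_exp_bound_primalDual 𝒢.laplacian_transpose
    𝒢.dotProduct_laplacian_nonneg hc hLc 𝒢.sum_laplacian_mulVec (hpos i₀) hH.le
  -- The equilibrium is `z = y`, `lam = l` constant, and `v = vb` up to a constant; `d - y` sums to
  -- zero by feasibility.
  obtain ⟨vb, hvb⟩ := 𝒢.exists_laplacian_mulVec_eq hconn (r := d - y) (by
    simp [show ∑ i, y i = ∑ i, d i from hy])
  refine ⟨γ, C * (2 + ‖y‖ + |l| + 2 * ‖vb‖), hγ, by positivity,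
    fun z lam v hz hlam hv t ht => ?_⟩
  -- The conserved mean selects the equilibrium `vb + m` belonging to the trajectory; subtracting it
  -- gives an error of sum zero.
  set m : ℝ := (∑ i, (v 0 i - vb i)) / N with hm
  have hml : |m| ≤ ‖v 0‖ + ‖vb‖ := by
    rw [hm, abs_div, abs_of_pos hN, div_le_iff₀ hN]
    calc |∑ i, (v 0 i - vb i)| ≤ ∑ i, |v 0 i - vb i| := Finset.abs_sum_le_sum_abs _ _
      _ ≤ ∑ _i : Fin N, (‖v 0‖ + ‖vb‖) := Finset.sum_le_sum fun i _ =>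
          (norm_le_pi_norm (v 0 - vb) i).trans (norm_sub_le _ _)
      _ = _ := by rw [Finset.sum_const, Finset.card_univ, Fintype.card_fin, nsmul_eq_mul, mul_comm]
  have hb := hbound (fun t => z t - y) (fun t => lam t - fun _ => l)
    (fun t => v t - vb - fun _ => m) (fun t i => deriv (f i) (z t i) - l) ?_ ?_ ?_ ?_ ?_ ?_ t ht
  · refine hb.trans (mul_le_mul_of_nonneg_right ?_ (Real.exp_pos _).le)
    rw [mul_assoc]
    refine mul_le_mul_of_nonneg_left ?_ hC.le
    have h1 := norm_sub_le (z 0) y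
    have h2 := norm_sub_le (lam 0) fun _ => l
    have h3 := norm_sub_le (v 0 - vb) fun _ => m
    have h4 := norm_sub_le (v 0) vb
    rw [pi_norm_const, Real.norm_eq_abs] at h2 h3
    have n1 := norm_nonneg (z 0)
    have n2 := norm_nonneg (lam 0)
    have n3 := norm_nonneg (v 0)
    have n4 : 0 ≤ (‖y‖ + |l| + 2 * ‖vb‖) * (‖z 0‖ + ‖lam 0‖ + ‖v 0‖) := by positivity
    linarith
  · intro t ht
    rw [hasDerivWithinAt_pi]
    intro i
    refine ((hz t ht i).sub_const (y i)).congr_deriv ?_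
    simp only [Pi.add_apply, Pi.neg_apply, Pi.sub_apply]
    ring
  · intro t ht
    rw [hasDerivWithinAt_pi]
    intro i
    refine ((hlam t ht i).sub_const l).congr_deriv ?_
    simp only [mulVec_sub, 𝒢.laplacian_mulVec_const, hvb]
    simp only [𝒢.laplacian_mulVec, Pi.neg_apply, Pi.sub_apply, Pi.zero_apply]
    ring
  · intro t ht
    rw [hasDerivWithinAt_pi]
    intro i
    refine (((hv t ht i).sub_const (vb i)).sub_const m).congr_deriv ?_
    rw [mulVec_sub, 𝒢.laplacian_mulVec_const, 𝒢.laplacian_mulVec, sub_zero]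
  · intro t
    -- All summands are nonnegative, so the coordinate attaining the sup norm alone gives the bound.
    obtain ⟨j, hj⟩ := Finite.exists_max fun i => ‖(z t - y) i‖
    have hnorm : ‖z t - y‖ = ‖(z t - y) j‖ :=
      le_antisymm ((pi_norm_le_iff_of_nonneg (norm_nonneg _)).2 hj) (norm_le_pi_norm _ j)
    have hterm : ∀ i, hlo i₀ * (z t i - y i) ^ 2
        ≤ (z t i - y i) * (deriv (f i) (z t i) - l) := fun i => by
      rw [← hl i]
      exact (mul_le_mul_of_nonneg_right (hi₀ i) (sq_nonneg _)).trans ((hf i).mul_sq_le _ _)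
    rw [hnorm, Real.norm_eq_abs, sq_abs]
    refine (hterm j).trans (Finset.single_le_sum
      (f := fun i => (z t i - y i) * (deriv (f i) (z t i) - l)) (fun i _ => ?_)
      (Finset.mem_univ j))
    exact (mul_nonneg (hpos i₀).le (sq_nonneg _)).trans (hterm i)
  · intro t
    rw [pi_norm_le_iff_of_nonneg (by positivity)]
    intro i
    rw [← hl i]
    calc ‖deriv (f i) (z t i) - deriv (f i) (y i)‖ ≤ hhi i * |z t i - y i| :=
          (hf i).abs_sub_le (hpos i) _ _
      _ ≤ hhi i₁ * ‖z t - y‖ :=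
          mul_le_mul (hi₁ i) (norm_le_pi_norm (z t - y) i) (abs_nonneg _) hH.le
  · simp only [Pi.sub_apply]
    rw [Finset.sum_sub_distrib, hm]
    simp
    field_simp
    simp

end OptimalSignalGenerator

/-! ### Global solutions for Lipschitz vector fields. -/

section GlobalExistence

variable {E : Type*} [NormedAddCommGroup E] [NormedSpace ℝ E]

/-- Solutions on adjacent intervals can be glued. -/
theorem exists_solution_extend {F : E → E} {a b c : ℝ} (hab : a ≤ b) (hbc : b ≤ c) {α β : ℝ → E}
    (hα : ∀ t ∈ Set.Icc a b, HasDerivWithinAt α (F (α t)) (Set.Icc a b) t)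
    (hβ : ∀ t ∈ Set.Icc b c, HasDerivWithinAt β (F (β t)) (Set.Icc b c) t) (h : α b = β b) :
    ∃ σ : ℝ → E, Set.EqOn σ α (Set.Icc a b) ∧
      Set.EqOn σ β (Set.Icc b c) ∧
      ∀ t ∈ Set.Icc a c, HasDerivWithinAt σ (F (σ t)) (Set.Icc a c) t := by
  classical
  set σ : ℝ → E := fun t => if t ≤ b then α t else β t with hσ
  have h1 : Set.EqOn σ α (Set.Icc a b) := fun t ht => if_pos ht.2
  have h2 : Set.EqOn σ β (Set.Icc b c) := fun t ht => by
    rcases ht.1.eq_or_lt with he | hlt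
    · rw [← he, ← h]; exact if_pos le_rfl
    · exact if_neg (not_le.2 hlt)
  have d1 : ∀ t ∈ Set.Icc a b, HasDerivWithinAt σ (F (σ t)) (Set.Icc a b) t := fun t ht => by
    rw [h1 ht]; exact (hα t ht).congr h1 (h1 ht)
  have d2 : ∀ t ∈ Set.Icc b c, HasDerivWithinAt σ (F (σ t)) (Set.Icc b c) t := fun t ht => by
    rw [h2 ht]; exact (hβ t ht).congr h2 (h2 ht)
  refine ⟨σ, h1, h2, fun t ht => ?_⟩
  rcases lt_trichotomy t b with hlt | rfl | hgt
  · refine (d1 t ⟨ht.1, hlt.le⟩).mono_of_mem_nhdsWithin ?_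
    filter_upwards [self_mem_nhdsWithin, nhdsWithin_le_nhds (Iio_mem_nhds hlt)] with s hs hs'
    exact ⟨hs.1, le_of_lt hs'⟩
  -- At the junction both one-sided derivatives equal `F (σ b)`.
  · rw [← Set.Icc_union_Icc_eq_Icc hab hbc]
    exact (d1 t ⟨hab, le_rfl⟩).union (d2 t ⟨le_rfl, hbc⟩)
  · refine (d2 t ⟨hgt.le, ht.2⟩).mono_of_mem_nhdsWithin ?_
    filter_upwards [self_mem_nhdsWithin, nhdsWithin_le_nhds (Ioi_mem_nhds hgt)] with s hs hs'
    exact ⟨le_of_lt hs', hs.2⟩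

/-- A globally Lipschitz vector field has a solution on a time interval of uniform length. -/
theorem exists_solution_Icc_of_lipschitz [CompleteSpace E] {F : E → E} {K : ℝ≥0}
    (hF : LipschitzWith K F) (t₀ : ℝ) (x : E) :
    ∃ α : ℝ → E, α t₀ = x ∧ ∀ t ∈ Set.Icc t₀ (t₀ + 1 / (2 * (K + 1))),
      HasDerivWithinAt α (F (α t)) (Set.Icc t₀ (t₀ + 1 / (2 * (K + 1)))) t := by
  have hT : 0 < 1 / (2 * ((K : ℝ) + 1)) := by positivity
  -- On the ball of radius `‖F x‖` about `x` the field is at most `(1 + K) ‖F x‖`. Over time `1 / (2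
  -- (K + 1))` a solution moves at most `‖F x‖ / 2`, so the length does not depend on `x`.
  have hPL : IsPicardLindelof (fun _ => F)
      (⟨t₀, le_rfl, by linarith⟩ : Set.Icc t₀ (t₀ + 1 / (2 * ((K : ℝ) + 1)))) x ‖F x‖₊ 0
      (‖F x‖₊ + K * ‖F x‖₊) K := by
    refine ⟨fun _ _ => hF.lipschitzOnWith, fun _ _ => continuousOn_const, fun _ _ y hy => ?_, ?_⟩
    · have h1 := hF.dist_le_mul y x
      rw [Metric.mem_closedBall] at hy
      rw [dist_eq_norm] at h1
      have h2 : ‖F y‖ ≤ ‖F y - F x‖ + ‖F x‖ := by simpa using norm_add_le (F y - F x) (F x)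
      have h3 := mul_le_mul_of_nonneg_left hy K.coe_nonneg
      push_cast
      simp only [coe_nnnorm] at h3 ⊢
      exact h2.trans (by linarith)
    · have hmax : max (t₀ + 1 / (2 * ((K : ℝ) + 1)) - t₀) (t₀ - t₀) = 1 / (2 * ((K : ℝ) + 1)) := by
        rw [add_sub_cancel_left, sub_self, max_eq_left hT.le]
      simp only [hmax]
      push_cast
      rw [sub_zero, show (‖F x‖ + K * ‖F x‖) * (1 / (2 * ((K : ℝ) + 1))) = ‖F x‖ / 2 by
        field_simp; ring]
      linarith [norm_nonneg (F x)]
  exact hPL.exists_eq_forall_mem_Icc_hasDerivWithinAt₀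

/-- A globally Lipschitz vector field has a solution on `[0, ∞)` from every initial value. -/
theorem exists_solution_Ici_of_lipschitz [CompleteSpace E] {F : E → E} {K : ℝ≥0}
    (hF : LipschitzWith K F) (x : E) :
    ∃ α : ℝ → E, α 0 = x ∧ ∀ t, 0 ≤ t → HasDerivWithinAt α (F (α t)) (Set.Ici 0) t := by
  set T : ℝ := 1 / (2 * ((K : ℝ) + 1)) with hTdef
  have hT : 0 < T := by positivity
  have hfin : ∀ n : ℕ, ∃ α : ℝ → E, α 0 = x ∧
      ∀ t ∈ Set.Icc 0 (n * T), HasDerivWithinAt α (F (α t)) (Set.Icc 0 (n * T)) t := by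
    intro n
    induction n with
    | zero =>
      refine ⟨fun _ => x, rfl, fun t _ => ?_⟩
      simp only [Nat.cast_zero, zero_mul, Set.Icc_self]
      exact hasDerivWithinAt_iff_hasFDerivWithinAt.2
        (HasFDerivWithinAt.of_subsingleton Set.subsingleton_singleton)
    | succ n ih =>
      obtain ⟨α, h0, hα⟩ := ih
      obtain ⟨β, hβ0, hβ⟩ := exists_solution_Icc_of_lipschitz hF (n * T) (α (n * T))
      have hnT : 0 ≤ n * T := by positivity
      obtain ⟨σ, h1, -, h3⟩ := exists_solution_extend hnT (by linarith) hα hβ hβ0.symm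
      refine ⟨σ, by rw [h1 ⟨le_rfl, hnT⟩, h0], ?_⟩
      rw [show ((n + 1 : ℕ) : ℝ) * T = n * T + T by push_cast; ring]
      exact h3
  choose α hα0 hα using hfin
  -- The solutions on `[0, n T]` were chosen independently; uniqueness makes them compatible.
  have huniq : ∀ m n : ℕ, m ≤ n → Set.EqOn (α m) (α n) (Set.Icc 0 (m * T)) := by
    intro m n hmn
    have hle : (m : ℝ) * T ≤ n * T := mul_le_mul_of_nonneg_right (by exact_mod_cast hmn) hT.le
    have hd : ∀ k : ℕ, m ≤ k → (∀ t ∈ Set.Ico 0 (m * T),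
        HasDerivWithinAt (α k) (F (α k t)) (Set.Ici t) t) := by
      intro k hk t ht
      have hle : (m : ℝ) * T ≤ k * T := mul_le_mul_of_nonneg_right (by exact_mod_cast hk) hT.le
      refine (hα k t ⟨ht.1, ht.2.le.trans hle⟩).mono_of_mem_nhdsWithin ?_
      filter_upwards [self_mem_nhdsWithin,
        nhdsWithin_le_nhds (Iio_mem_nhds (ht.2.trans_le hle))] with s hs hs'
      exact ⟨ht.1.trans hs, le_of_lt hs'⟩
    exact ODE_solution_unique_of_mem_Icc_right (v := fun _ => F) (s := fun _ => Set.univ) (K := K)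
      (fun _ _ => hF.lipschitzOnWith)
      (fun t ht => (hα m t ht).continuousWithinAt)
      (hd m le_rfl) (fun _ _ => trivial)
      (fun t ht => ((hα n t ⟨ht.1, ht.2.trans hle⟩).continuousWithinAt).mono
        (Set.Icc_subset_Icc_right hle))
      (hd n hmn) (fun _ _ => trivial) (by rw [hα0, hα0])
  -- Strictness makes `[0, n T]` a neighbourhood of `t` within `[0, ∞)`.
  have hex : ∀ t : ℝ, ∃ n : ℕ, t < n * T := fun t => by
    obtain ⟨n, hn⟩ := exists_nat_gt (t / T)
    exact ⟨n, (div_lt_iff₀ hT).1 hn⟩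
  choose ν hν using hex
  have hagree : ∀ (n : ℕ) (t : ℝ), 0 ≤ t → t ≤ n * T → α (ν t) t = α n t := by
    intro n t ht htn
    rcases le_total (ν t) n with h | h
    · exact huniq _ _ h ⟨ht, (hν t).le⟩
    · exact (huniq _ _ h ⟨ht, htn⟩).symm
  refine ⟨fun t => α (ν t) t, hα0 _, fun t ht => ?_⟩
  have hmem : Set.Icc 0 (ν t * T) ∈ 𝓝[Set.Ici 0] t := by
    filter_upwards [self_mem_nhdsWithin, nhdsWithin_le_nhds (Iio_mem_nhds (hν t))] with s hs hs'
    exact ⟨hs, le_of_lt hs'⟩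
  exact ((hα (ν t) t ⟨ht, (hν t).le⟩).congr (fun s hs => hagree _ s hs.1 hs.2)
    rfl).mono_of_mem_nhdsWithin hmem

end GlobalExistence

/-! ### Existence of closed-loop trajectories. -/

section ClosedLoopLipschitz

/-- Lipschitz with some constant. -/
def IsLipschitz {X Y : Type*} [PseudoEMetricSpace X] [PseudoEMetricSpace Y] (f : X → Y) : Prop :=
  ∃ K : ℝ≥0, LipschitzWith K f

namespace IsLipschitz

variable {X : Type*} [PseudoEMetricSpace X]

theorem pi {ι : Type*} [Fintype ι] {Y : ι → Type*} [∀ i, PseudoEMetricSpace (Y i)]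
    {f : X → ∀ i, Y i} (h : ∀ i, IsLipschitz fun x => f x i) : IsLipschitz f := by
  choose K hK using h
  refine ⟨∑ i, K i, fun x y => (edist_pi_le_iff.2 fun i => (hK i x y).trans ?_)⟩
  gcongr
  exact Finset.single_le_sum (fun _ _ => zero_le) (Finset.mem_univ i)

theorem apply {ι : Type*} [Fintype ι] {Y : ι → Type*} [∀ i, PseudoEMetricSpace (Y i)]
    {f : X → ∀ i, Y i} (h : IsLipschitz f) (i : ι) : IsLipschitz fun x => f x i :=
  h.imp fun _ hK x y => (edist_le_pi_edist _ _ i).trans (hK x y)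

theorem prodMk {Y Z : Type*} [PseudoEMetricSpace Y] [PseudoEMetricSpace Z] {f : X → Y} {g : X → Z}
    (hf : IsLipschitz f) (hg : IsLipschitz g) : IsLipschitz fun x => (f x, g x) :=
  let ⟨_, hK⟩ := hf
  let ⟨_, hL⟩ := hg
  ⟨_, hK.prodMk hL⟩

theorem add {Y : Type*} [SeminormedAddCommGroup Y] {f g : X → Y} (hf : IsLipschitz f)
    (hg : IsLipschitz g) : IsLipschitz fun x => f x + g x :=
  let ⟨_, hK⟩ := hf
  let ⟨_, hL⟩ := hg
  ⟨_, hK.add hL⟩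

theorem neg {Y : Type*} [SeminormedAddCommGroup Y] {f : X → Y} (hf : IsLipschitz f) :
    IsLipschitz fun x => -f x :=
  hf.imp fun _ hK => hK.neg

theorem sub {Y : Type*} [SeminormedAddCommGroup Y] {f g : X → Y} (hf : IsLipschitz f)
    (hg : IsLipschitz g) : IsLipschitz fun x => f x - g x :=
  let ⟨_, hK⟩ := hf
  let ⟨_, hL⟩ := hg
  ⟨_, hK.sub hL⟩

theorem const {Y : Type*} [PseudoEMetricSpace Y] (y : Y) : IsLipschitz fun _ : X => y :=
  ⟨0, LipschitzWith.const y⟩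

theorem mulVec {m n : ℕ} (M : Matrix (Fin m) (Fin n) ℝ) {f : X → Fin n → ℝ} (hf : IsLipschitz f) :
    IsLipschitz fun x => M *ᵥ f x :=
  let ⟨_, hK⟩ := hf
  ⟨_, (LinearMap.toContinuousLinearMap M.mulVecLin).lipschitz.comp hK⟩

theorem comp {Y Z : Type*} [PseudoEMetricSpace Y] [PseudoEMetricSpace Z] {g : Y → Z} {f : X → Y}
    (hg : IsLipschitz g) (hf : IsLipschitz f) : IsLipschitz fun x => g (f x) :=
  let ⟨_, hK⟩ := hf
  let ⟨_, hL⟩ := hg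
  ⟨_, hL.comp hK⟩

end IsLipschitz

theorem HessianBounds.isLipschitz_deriv {f : ℝ → ℝ} {a b : ℝ} (ha : 0 < a)
    (hf : HessianBounds f a b) : IsLipschitz (deriv f) := by
  have hb : 0 ≤ b := ha.le.trans ((hf.lower 0).trans (hf.upper 0))
  exact ⟨⟨b, hb⟩, LipschitzWith.of_dist_le_mul fun x y => hf.abs_sub_le ha y x⟩

variable {N : ℕ} {n q : Fin N → ℕ}

/-- The normed space underlying the states of the closed loop. -/
abbrev NetTuple (n q : Fin N → ℕ) : Type :=
  (∀ i, Fin (n i) → ℝ) × (∀ i, Fin (q i) → ℝ) × (∀ i, Fin (q i) → ℝ) × (Fin N → ℝ) ×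
    (Fin N → ℝ) × (Fin N → ℝ)

def NetState.toTuple (s : NetState n q) : NetTuple n q := (s.x, s.ω, s.ηbar, s.z, s.lam, s.v)

def NetState.ofTuple (p : NetTuple n q) : NetState n q :=
  ⟨p.1, p.2.1, p.2.2.1, p.2.2.2.1, p.2.2.2.2.1, p.2.2.2.2.2⟩

/-- Apart from the constants `d`, everything is linear except `deriv (f i)`, which the Hessian
bounds make Lipschitz. -/
theorem isLipschitz_closedLoop (P : ∀ i, Agent (n i) (q i)) (G : ∀ i, Gains (n i) (q i))
    (𝒢 : WeightedGraph N) {f : Fin N → ℝ → ℝ} {d hlo hhi : Fin N → ℝ} (hpos : ∀ i, 0 < hlo i)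
    (hf : ∀ i, HessianBounds (f i) (hlo i) (hhi i)) :
    IsLipschitz fun p : NetTuple n q => (closedLoop P G 𝒢 f d (NetState.ofTuple p)).toTuple := by
  have lx : IsLipschitz fun p : NetTuple n q => p.1 := ⟨1, LipschitzWith.prod_fst⟩
  have r1 : IsLipschitz fun p : NetTuple n q => p.2 := ⟨1, LipschitzWith.prod_snd⟩
  have lω : IsLipschitz fun p : NetTuple n q => p.2.1 := .comp ⟨1, LipschitzWith.prod_fst⟩ r1
  have r2 : IsLipschitz fun p : NetTuple n q => p.2.2 := .comp ⟨1, LipschitzWith.prod_snd⟩ r1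
  have lη : IsLipschitz fun p : NetTuple n q => p.2.2.1 := .comp ⟨1, LipschitzWith.prod_fst⟩ r2
  have r3 : IsLipschitz fun p : NetTuple n q => p.2.2.2 := .comp ⟨1, LipschitzWith.prod_snd⟩ r2
  have lz : IsLipschitz fun p : NetTuple n q => p.2.2.2.1 := .comp ⟨1, LipschitzWith.prod_fst⟩ r3
  have r4 : IsLipschitz fun p : NetTuple n q => p.2.2.2.2 := .comp ⟨1, LipschitzWith.prod_snd⟩ r3
  have ll : IsLipschitz fun p : NetTuple n q => p.2.2.2.2.1 :=
    .comp ⟨1, LipschitzWith.prod_fst⟩ r4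
  have lv : IsLipschitz fun p : NetTuple n q => p.2.2.2.2.2 :=
    .comp ⟨1, LipschitzWith.prod_snd⟩ r4
  have lu : ∀ i, IsLipschitz fun p : NetTuple n q => control G (NetState.ofTuple p) i := fun i =>
    (((lx.apply i).mulVec _).add (((lη.apply i).add ((lx.apply i).mulVec _)).mulVec _)).add
      (IsLipschitz.mulVec _ (IsLipschitz.pi fun _ => lz.apply i))
  have ld : ∀ {g : NetTuple n q → Fin N → ℝ}, IsLipschitz g →
      ∀ i, IsLipschitz fun p => 𝒢.diffusion (g p) i := fun hg i => by
    have := (hg.mulVec 𝒢.laplacian).apply i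
    simpa only [𝒢.laplacian_mulVec] using this
  refine .prodMk (.pi fun i => ?_) (.prodMk (.pi fun i => ?_) (.prodMk (.pi fun i => ?_)
    (.prodMk (.pi fun i => ?_) (.prodMk (.pi fun i => ?_) (.pi fun i => ?_)))))
  · exact (((lx.apply i).mulVec _).add ((lu i).mulVec _)).add ((lω.apply i).mulVec _)
  · exact (lω.apply i).mulVec _
  · exact (((lη.apply i).mulVec _).add ((lx.apply i).mulVec _)).sub ((lu i).mulVec _)
  · exact (((hf i).isLipschitz_deriv (hpos i)).comp (lz.apply i)).neg.add (ll.apply i)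
  · exact (((ld ll i).neg.sub (ld lv i)).add (.const _)).sub (lz.apply i)
  · exact ld ll i

theorem hasDerivWithinAt_fst {E F : Type*} [NormedAddCommGroup E] [NormedSpace ℝ E]
    [NormedAddCommGroup F] [NormedSpace ℝ F] {α : ℝ → E × F} {α' : E × F} {s : Set ℝ} {t : ℝ}
    (h : HasDerivWithinAt α α' s t) : HasDerivWithinAt (fun τ => (α τ).1) α'.1 s t :=
  (ContinuousLinearMap.fst ℝ E F).hasFDerivAt.comp_hasDerivWithinAt t h

theorem hasDerivWithinAt_snd {E F : Type*} [NormedAddCommGroup E] [NormedSpace ℝ E]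
    [NormedAddCommGroup F] [NormedSpace ℝ F] {α : ℝ → E × F} {α' : E × F} {s : Set ℝ} {t : ℝ}
    (h : HasDerivWithinAt α α' s t) : HasDerivWithinAt (fun τ => (α τ).2) α'.2 s t :=
  (ContinuousLinearMap.snd ℝ E F).hasFDerivAt.comp_hasDerivWithinAt t h

/-- The closed loop has a trajectory from every initial state. -/
theorem exists_isTrajectory (P : ∀ i, Agent (n i) (q i)) (G : ∀ i, Gains (n i) (q i))
    (𝒢 : WeightedGraph N) {f : Fin N → ℝ → ℝ} {d hlo hhi : Fin N → ℝ} (hpos : ∀ i, 0 < hlo i)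
    (hf : ∀ i, HessianBounds (f i) (hlo i) (hhi i)) (s₀ : NetState n q) :
    ∃ s : ℝ → NetState n q, IsTrajectory (closedLoop P G 𝒢 f d) s ∧ s 0 = s₀ := by
  obtain ⟨K, hK⟩ := isLipschitz_closedLoop P G 𝒢 (d := d) hpos hf
  obtain ⟨α, h0, hα⟩ := exists_solution_Ici_of_lipschitz hK s₀.toTuple
  have d2 := fun t ht => hasDerivWithinAt_snd (hα t ht)
  have d3 := fun t ht => hasDerivWithinAt_snd (d2 t ht)
  have d4 := fun t ht => hasDerivWithinAt_snd (d3 t ht)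
  have d5 := fun t ht => hasDerivWithinAt_snd (d4 t ht)
  refine ⟨fun t => NetState.ofTuple (α t),
    ⟨fun t ht => hasDerivWithinAt_pi.1 (hasDerivWithinAt_fst (hα t ht)),
      fun t ht => hasDerivWithinAt_pi.1 (hasDerivWithinAt_fst (d2 t ht)),
      fun t ht => hasDerivWithinAt_pi.1 (hasDerivWithinAt_fst (d3 t ht)),
      fun t ht => hasDerivWithinAt_pi.1 (hasDerivWithinAt_fst (d4 t ht)),
      fun t ht => hasDerivWithinAt_pi.1 (hasDerivWithinAt_fst (d5 t ht)),
      fun t ht => hasDerivWithinAt_pi.1 (hasDerivWithinAt_snd (d5 t ht))⟩, ?_⟩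
  show NetState.ofTuple (α 0) = s₀
  rw [h0]
  rfl

end ClosedLoopLipschitz

/-! ### Disturbance rejection and tracking by one agent. -/

section OutputRegulation

theorem exists_norm_mulVec_le {m n : ℕ} (M : Matrix (Fin m) (Fin n) ℝ) :
    ∃ c : ℝ, 0 ≤ c ∧ ∀ x, ‖M *ᵥ x‖ ≤ c * ‖x‖ :=
  ⟨_, norm_nonneg _, (LinearMap.toContinuousLinearMap M.mulVecLin).le_opNorm⟩

variable {n q : ℕ} {P : Agent n q} {G : Gains n q}

/-- The estimation error of the disturbance observer is autonomous. -/
theorem observer_error_eq (x : Fin n → ℝ) (ω ηbar : Fin q → ℝ) (u : Fin 1 → ℝ) :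
    ((P.S - G.Lbar * P.E) *ᵥ ηbar
        + (P.S * G.Lbar - G.Lbar * P.E * G.Lbar - G.Lbar * P.A) *ᵥ x - (G.Lbar * P.B) *ᵥ u)
      + G.Lbar *ᵥ (P.A *ᵥ x + P.B *ᵥ u + P.E *ᵥ ω) - P.S *ᵥ ω
      = (P.S - G.Lbar * P.E) *ᵥ (ηbar + G.Lbar *ᵥ x - ω) := by
  simp only [sub_mulVec, mulVec_add, mulVec_sub, ← mulVec_mulVec]
  abel

/-- The tracking error is driven by the estimation error and the error of the generator. -/
theorem tracking_error_eq (hR : P.RegulatorEquations G.X₁ G.U₁ G.X₂ G.U₂) (x : Fin n → ℝ)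
    (ω η : Fin q → ℝ) (z y : Fin 1 → ℝ) :
    (P.A *ᵥ x + P.B *ᵥ (G.K₁ *ᵥ x + G.K₂ *ᵥ η + G.K₃ *ᵥ z) + P.E *ᵥ ω) - G.X₁ *ᵥ (P.S *ᵥ ω)
      = (P.A + P.B * G.K₁) *ᵥ (x - G.X₁ *ᵥ ω - G.X₂ *ᵥ y)
        + (P.B *ᵥ (G.K₂ *ᵥ (η - ω)) + P.B *ᵥ (G.K₃ *ᵥ (z - y))) := by
  -- The gains are such that the control is `K₁ ξ + U₁ ω + U₂ y + K₂ (η - ω) + K₃ (z - y)` with `ξ =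
  -- x - X₁ ω - X₂ y`; the regulator equations absorb the terms in `ω` and `y`.
  have h1 := congrArg (fun M => M *ᵥ ω) hR.state₁
  have h2 := congrArg (fun M => M *ᵥ y) hR.state₂
  simp only [add_mulVec, ← mulVec_mulVec, zero_mulVec] at h1 h2
  rw [h1]
  simp only [Gains.K₂, Gains.K₃, sub_mulVec, add_mulVec, mulVec_add, mulVec_sub, ← mulVec_mulVec]
  rw [eq_comm, add_comm, ← eq_neg_iff_add_eq_zero] at h2
  rw [h2]
  abel

/-- The output of one agent follows an exponentially converging reference signal. -/
theorem Gains.Admissible.exists_exp_bound_output (hG : G.Admissible P) (y : ℝ) {c : ℝ}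
    (hc : 0 < c) :
    ∃ γ C : ℝ, 0 < γ ∧ 0 < C ∧ ∀ (x : ℝ → Fin n → ℝ) (ω ηbar : ℝ → Fin q → ℝ) (z : ℝ → ℝ)
      (u : ℝ → Fin 1 → ℝ) (b : ℝ), 0 ≤ b →
      (∀ t, u t = G.K₁ *ᵥ x t + G.K₂ *ᵥ (ηbar t + G.Lbar *ᵥ x t) + G.K₃ *ᵥ (fun _ => z t)) →
      (∀ t, 0 ≤ t → HasDerivWithinAt x (P.A *ᵥ x t + P.B *ᵥ u t + P.E *ᵥ ω t) (Set.Ici 0) t) →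
      (∀ t, 0 ≤ t → HasDerivWithinAt ω (P.S *ᵥ ω t) (Set.Ici 0) t) →
      (∀ t, 0 ≤ t → HasDerivWithinAt ηbar ((P.S - G.Lbar * P.E) *ᵥ ηbar t
        + (P.S * G.Lbar - G.Lbar * P.E * G.Lbar - G.Lbar * P.A) *ᵥ x t
        - (G.Lbar * P.B) *ᵥ u t) (Set.Ici 0) t) →
      (∀ t, 0 ≤ t → |z t - y| ≤ b * Real.exp (-c * t)) →
      ∀ t, 0 ≤ t → |(P.C *ᵥ x t) 0 - y|
        ≤ C * (1 + (‖x 0‖ + ‖ω 0‖ + ‖ηbar 0‖) + b) * Real.exp (-γ * t) := by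
  -- Since `γ₁ ≤ c`, both inputs of the tracking error, from the observer and from the generator,
  -- decay at rate `γ₁`.
  obtain ⟨γ₁, C₁, hγ₁, hγc, hC₁, hobs⟩ := hG.observer.exists_exp_bound hc
  obtain ⟨γ₂, C₂, hγ₂, -, hC₂, htrack⟩ := hG.feedback.exists_exp_bound hγ₁
  obtain ⟨k₁, hk₁, hL⟩ := exists_norm_mulVec_le G.Lbar
  obtain ⟨k₂, hk₂, hX⟩ := exists_norm_mulVec_le G.X₁
  obtain ⟨k₃, hk₃, hB₂⟩ := exists_norm_mulVec_le (P.B * G.K₂)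
  obtain ⟨k₄, hk₄, hB₃⟩ := exists_norm_mulVec_le (P.B * G.K₃)
  obtain ⟨k₅, hk₅, hCx⟩ := exists_norm_mulVec_le P.C
  set k₆ : ℝ := ‖G.X₂ *ᵥ (fun _ : Fin 1 => y)‖ with hk₆
  have hk₆0 : 0 ≤ k₆ := norm_nonneg _
  set Γ : ℝ := 1 + k₂ + k₆ + k₃ * C₁ * (1 + k₁) + k₄ with hΓ
  have hΓ0 : 0 < Γ := by positivity
  -- `Γ` dominates the initial tracking error together with the input amplitude `b'`; `k₅ + 1` keeps
  -- the constant positive even if `k₅ = 0`.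
  refine ⟨γ₂, (k₅ + 1) * (C₂ * Γ), hγ₂, by positivity,
    fun x ω ηbar z u b hb hu hx hω hη hz t ht => ?_⟩
  set e : ℝ → Fin q → ℝ := fun t => ηbar t + G.Lbar *ᵥ x t - ω t with he
  set ξ : ℝ → Fin n → ℝ := fun t => x t - G.X₁ *ᵥ ω t - G.X₂ *ᵥ (fun _ => y) with hξ
  have hed : ∀ t, 0 ≤ t →
      HasDerivWithinAt e ((P.S - G.Lbar * P.E) *ᵥ e t + (0 : ℝ → Fin q → ℝ) t) (Set.Ici 0) t := by
    intro t ht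
    refine (((hη t ht).add (hasDerivWithinAt_mulVec G.Lbar (hx t ht))).sub
      (hω t ht)).congr_deriv ?_
    rw [observer_error_eq, Pi.zero_apply, add_zero]
  have heb := hobs e 0 0 le_rfl hed (fun t _ => by simp)
  rw [add_zero] at heb
  have hξd : ∀ t, 0 ≤ t → HasDerivWithinAt ξ ((P.A + P.B * G.K₁) *ᵥ ξ t
      + (P.B *ᵥ (G.K₂ *ᵥ e t) + P.B *ᵥ (G.K₃ *ᵥ ((fun _ => z t) - fun _ => y)))) (Set.Ici 0) t := by
    intro t ht
    refine (((hx t ht).sub (hasDerivWithinAt_mulVec G.X₁ (hω t ht))).sub_const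
      (G.X₂ *ᵥ fun _ => y)).congr_deriv ?_
    rw [hu, tracking_error_eq hG.regulator _ _ _ _ (fun _ => y)]
  set b' : ℝ := k₃ * (C₁ * ‖e 0‖) + k₄ * b with hb'
  have hξb := htrack ξ (fun t => P.B *ᵥ (G.K₂ *ᵥ e t)
      + P.B *ᵥ (G.K₃ *ᵥ ((fun _ => z t) - fun _ => y))) b' (by positivity) hξd (fun t ht => by
    have h1 : ‖P.B *ᵥ (G.K₂ *ᵥ e t)‖ ≤ k₃ * (C₁ * ‖e 0‖ * Real.exp (-γ₁ * t)) := by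
      rw [mulVec_mulVec]
      exact (hB₂ _).trans (mul_le_mul_of_nonneg_left (heb t ht) hk₃)
    have h2 : ‖P.B *ᵥ (G.K₃ *ᵥ ((fun _ => z t) - fun _ => y))‖
        ≤ k₄ * (b * Real.exp (-γ₁ * t)) := by
      rw [mulVec_mulVec]
      refine (hB₃ _).trans (mul_le_mul_of_nonneg_left ?_ hk₄)
      have h3 : ‖((fun _ => z t) - fun _ => y : Fin 1 → ℝ)‖ = |z t - y| :=
        pi_norm_const (z t - y)
      rw [h3]
      refine (hz t ht).trans (mul_le_mul_of_nonneg_left (Real.exp_le_exp.2 ?_) hb)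
      nlinarith
    refine (norm_add_le _ _).trans ((add_le_add h1 h2).trans_eq ?_)
    rw [hb']
    ring) t ht
  -- Here `C X₁ = 0` hides the disturbance from the output and `C X₂ = 1` normalizes the reference.
  have hout : (P.C *ᵥ x t) 0 - y = (P.C *ᵥ ξ t) 0 := by
    rw [hξ]
    simp only [mulVec_sub, mulVec_mulVec, ← hG.regulator.output₁, ← hG.regulator.output₂,
      zero_mulVec, one_mulVec, sub_zero, Pi.sub_apply]
  have he0 : ‖e 0‖ ≤ (1 + k₁) * (‖x 0‖ + ‖ω 0‖ + ‖ηbar 0‖) := by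
    have h1 := norm_sub_le (ηbar 0 + G.Lbar *ᵥ x 0) (ω 0)
    have h2 := norm_add_le (ηbar 0) (G.Lbar *ᵥ x 0)
    have h3 := hL (x 0)
    have h4 := norm_nonneg (x 0)
    have h5 : 0 ≤ k₁ * ‖ω 0‖ := by positivity
    have h6 : 0 ≤ k₁ * ‖ηbar 0‖ := by positivity
    simp only [he]
    linarith only [h1, h2, h3, h4, h5, h6]
  set σ : ℝ := ‖x 0‖ + ‖ω 0‖ + ‖ηbar 0‖ with hσ
  have hσ0 : 0 ≤ σ := by positivity
  have hξ0 : ‖ξ 0‖ ≤ (1 + k₂) * σ + k₆ := by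
    have h1 := norm_sub_le (x 0 - G.X₁ *ᵥ ω 0) (G.X₂ *ᵥ fun _ => y)
    have h2 := norm_sub_le (x 0) (G.X₁ *ᵥ ω 0)
    have h3 := hX (ω 0)
    have h4 : 0 ≤ k₂ * ‖x 0‖ := by positivity
    have h5 : 0 ≤ k₂ * ‖ηbar 0‖ := by positivity
    have h6 := norm_nonneg (ω 0)
    have h7 := norm_nonneg (ηbar 0)
    simp only [hξ, hσ]
    linarith only [h1, h2, h3, h4, h5, h6, h7, hk₆.le, hk₆.ge]
  have htotal : ‖ξ 0‖ + b' ≤ Γ * (1 + σ + b) := by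
    have h1 : k₃ * (C₁ * ‖e 0‖) ≤ k₃ * C₁ * (1 + k₁) * σ := by
      calc k₃ * (C₁ * ‖e 0‖) ≤ k₃ * (C₁ * ((1 + k₁) * σ)) := by gcongr
        _ = _ := by ring
    have h2 : Γ * (1 + σ + b) = ((1 + k₂) * σ + k₆ + k₃ * C₁ * (1 + k₁) * σ + k₄ * b)
        + ((1 + k₂) * (1 + b) + k₆ * (σ + b) + k₃ * C₁ * (1 + k₁) * (1 + b)
          + k₄ * (1 + σ)) := by
      rw [hΓ]; ring
    have h3 : 0 ≤ (1 + k₂) * (1 + b) + k₆ * (σ + b) + k₃ * C₁ * (1 + k₁) * (1 + b)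
          + k₄ * (1 + σ) := by positivity
    rw [h2, hb']
    linarith only [h1, h3, hξ0]
  rw [hout]
  calc |(P.C *ᵥ ξ t) 0| ≤ ‖P.C *ᵥ ξ t‖ := norm_le_pi_norm (P.C *ᵥ ξ t) 0
    _ ≤ k₅ * ‖ξ t‖ := hCx _
    _ ≤ (k₅ + 1) * ‖ξ t‖ := mul_le_mul_of_nonneg_right (by linarith) (norm_nonneg _)
    _ ≤ (k₅ + 1) * (C₂ * (‖ξ 0‖ + b') * Real.exp (-γ₂ * t)) := by gcongr
    _ ≤ (k₅ + 1) * (C₂ * (Γ * (1 + σ + b)) * Real.exp (-γ₂ * t)) := by gcongr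
    _ = _ := by ring

theorem Agent.Standing.exists_admissible (hP : P.Standing)
    (hreg : ∃ X₁ U₁ X₂ U₂, P.RegulatorEquations X₁ U₁ X₂ U₂) :
    ∃ G : Gains n q, G.Admissible P := by
  obtain ⟨X₁, U₁, X₂, U₂, h⟩ := hreg
  obtain ⟨K, hK⟩ := hP.1.1.exists_isHurwitz
  obtain ⟨L, hL⟩ := hP.2.exists_isHurwitz
  exact ⟨⟨X₁, U₁, X₂, U₂, K, L⟩, h, hK, hL⟩

end OutputRegulation

/-! ### Assembly over the network. -/

section Network

variable {N : ℕ} {n q : Fin N → ℕ}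

/-- Given the generator's signal the agents are decoupled, so the worst rate and the worst constant
over the finitely many agents serve for all. -/
theorem exists_exp_bound_closedLoop (P : ∀ i, Agent (n i) (q i)) {G : ∀ i, Gains (n i) (q i)}
    (hG : ∀ i, (G i).Admissible (P i)) (𝒢 : WeightedGraph N)
    (hconn : 𝒢.toSimpleGraph.Connected) {f : Fin N → ℝ → ℝ} {d hlo hhi y : Fin N → ℝ} {l : ℝ}
    (hpos : ∀ i, 0 < hlo i) (hf : ∀ i, HessianBounds (f i) (hlo i) (hhi i))
    (hy : y ∈ feasible d) (hl : ∀ i, deriv (f i) (y i) = l) :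
    ∃ γ M : ℝ, 0 < γ ∧ 0 < M ∧ ∀ s : ℝ → NetState n q,
      IsTrajectory (closedLoop P G 𝒢 f d) s → ∀ i, ∀ t : ℝ, 0 ≤ t →
        |output P (s t) i - y i| ≤ M * (1 + (s 0).size) * Real.exp (-γ * t) := by
  have := hconn.nonempty
  obtain ⟨c, C₀, hc, hC₀, hgen⟩ := exists_exp_bound_generator 𝒢 hconn hpos hf hy hl
  choose γ C hγ hC hout using fun i => (hG i).exists_exp_bound_output (y i) hc
  obtain ⟨i₀, hi₀⟩ := Finite.exists_min γ
  obtain ⟨i₁, hi₁⟩ := Finite.exists_max C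
  refine ⟨γ i₀, C i₁ * (1 + C₀), hγ i₀, mul_pos (hC i₁) (by positivity), fun s hs i t ht => ?_⟩
  set σ : ℝ := (s 0).size with hσ
  have nx := norm_nonneg (s 0).x
  have nω := norm_nonneg (s 0).ω
  have nη := norm_nonneg (s 0).ηbar
  have nz := norm_nonneg (s 0).z
  have nl := norm_nonneg (s 0).lam
  have nv := norm_nonneg (s 0).v
  have hσ' : σ = ‖(s 0).x‖ + ‖(s 0).ω‖ + ‖(s 0).ηbar‖ + ‖(s 0).z‖ + ‖(s 0).lam‖ + ‖(s 0).v‖ := rfl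
  have hσ0 : 0 ≤ σ := by rw [hσ']; positivity
  have hz : ∀ t, 0 ≤ t → |(s t).z i - y i| ≤ C₀ * (1 + σ) * Real.exp (-c * t) := by
    intro t ht
    refine (norm_le_pi_norm ((s t).z - y) i).trans
      ((hgen (fun t => (s t).z) (fun t => (s t).lam) (fun t => (s t).v) hs.z hs.lam hs.v
        t ht).trans ?_)
    refine mul_le_mul_of_nonneg_right (mul_le_mul_of_nonneg_left ?_ hC₀.le) (Real.exp_pos _).le
    rw [hσ']
    linarith
  have h := hout i (fun t => (s t).x i) (fun t => (s t).ω i) (fun t => (s t).ηbar i)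
    (fun t => (s t).z i) (fun t => control G (s t) i) (C₀ * (1 + σ)) (by positivity)
    (fun t => rfl) (fun t ht => hs.x t ht i) (fun t ht => hs.ω t ht i)
    (fun t ht => hs.ηbar t ht i) hz t ht
  refine h.trans (mul_le_mul ?_ (Real.exp_le_exp.2 ?_) (Real.exp_pos _).le
    (mul_nonneg (mul_nonneg (hC i₁).le (by positivity)) (by positivity)))
  · have h1 := norm_le_pi_norm (s 0).x i
    have h2 := norm_le_pi_norm (s 0).ω i
    have h3 := norm_le_pi_norm (s 0).ηbar i
    have h4 : 1 + (‖(s 0).x i‖ + ‖(s 0).ω i‖ + ‖(s 0).ηbar i‖) + C₀ * (1 + σ)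
        ≤ (1 + C₀) * (1 + σ) := by
      have : ‖(s 0).x i‖ + ‖(s 0).ω i‖ + ‖(s 0).ηbar i‖ ≤ σ := by rw [hσ']; linarith
      linarith
    calc _ ≤ C i * ((1 + C₀) * (1 + σ)) := mul_le_mul_of_nonneg_left h4 (hC i).le
      _ ≤ C i₁ * ((1 + C₀) * (1 + σ)) := mul_le_mul_of_nonneg_right (hi₁ i) (by positivity)
      _ = _ := by ring
  · nlinarith [mul_le_mul_of_nonneg_right (hi₀ i) ht]

end Network

end SteadyStateRegulation

theorem theorem1 {N : ℕ} (n q : Fin N → ℕ)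
    (P : ∀ i, SteadyStateRegulation.Agent (n i) (q i))
    (𝒢 : SteadyStateRegulation.WeightedGraph N)
    (f : Fin N → ℝ → ℝ) (d hlo hhi : Fin N → ℝ)
    (hP : ∀ i, (P i).Standing)
    (hconn : 𝒢.toSimpleGraph.Connected)
    (hpos : ∀ i, 0 < hlo i)
    (hf : ∀ i, SteadyStateRegulation.HessianBounds (f i) (hlo i) (hhi i))
    (hreg : ∀ i, ∃ X₁ U₁ X₂ U₂, (P i).RegulatorEquations X₁ U₁ X₂ U₂) :
    (∃ G : ∀ i, SteadyStateRegulation.Gains (n i) (q i), ∀ i, (G i).Admissible (P i)) ∧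
    ∃ ystar : Fin N → ℝ,
      SteadyStateRegulation.IsOptimal f d ystar ∧
      (∀ y, SteadyStateRegulation.IsOptimal f d y → y = ystar) ∧
      ∀ G : ∀ i, SteadyStateRegulation.Gains (n i) (q i), (∀ i, (G i).Admissible (P i)) →
        (∀ s₀ : SteadyStateRegulation.NetState n q, ∃ s : ℝ → SteadyStateRegulation.NetState n q,
          SteadyStateRegulation.IsTrajectory
            (SteadyStateRegulation.closedLoop P G 𝒢 f d) s ∧ s 0 = s₀) ∧
        ∃ γ M : ℝ, 0 < γ ∧ 0 < M ∧
          ∀ s : ℝ → SteadyStateRegulation.NetState n q,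
            SteadyStateRegulation.IsTrajectory
              (SteadyStateRegulation.closedLoop P G 𝒢 f d) s →
            ∀ i, ∀ t : ℝ, 0 ≤ t →
              |SteadyStateRegulation.output P (s t) i - ystar i|
                ≤ M * (1 + (s 0).size) * Real.exp (-γ * t) := by
  -- Connectedness forces `N ≥ 1`, as the multiplier requires. The optimum is fixed before any gains
  -- are chosen.
  have := hconn.nonempty
  obtain ⟨y, l, hy, hl⟩ := SteadyStateRegulation.exists_multiplier (d := d) hpos hf
  choose G hG using fun i => (hP i).exists_admissible (hreg i)
  exact ⟨⟨G, hG⟩, y, SteadyStateRegulation.isOptimal_of_multiplier hpos hf hy hl,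
    fun p hp => hp.eq_of_multiplier hpos hf hy hl,
    fun G hG => ⟨fun s₀ => SteadyStateRegulation.exists_isTrajectory P G 𝒢 hpos hf s₀,
      SteadyStateRegulation.exists_exp_bound_closedLoop P hG 𝒢 hconn hpos hf hy hl⟩⟩
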